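/- Let $M$ be a smooth manifold of dimension $2n+1$ ($n\ge 0$). Multivectors and forms are contracted by $i_{X_1\wedge\dots\wedge X_k}\beta=\beta(X_1,\dots,X_k,\cdot)$ and dually $i_{\alpha_1\wedge\dots\wedge\alpha_k}P=P(\alpha_1,\dots,\alpha_k,\cdot)$; $[\,,]$ is the Schouten bracket normalized by $$i_{[P,Q]}\beta=(-1)^{q(p+1)}i_P\,d\,i_Q\beta+(-1)^p i_Q\,d\,i_P\beta-i_{P\wedge Q}\,d\beta$$ for a $p$-vector field $P$, a $q$-vector field $Q$ and a $(p+q-1)$-form $\beta$; $L_E$ is the Lie derivative. A *covariant pair* $(\omega,\Omega)$ consists of a smooth 1-form $\omega$ and a smooth 2-form $\Omega$ of constant rank $2r$, $0\le r\le n$, such that $\omega\wedge\Omega^r$ vanishes nowhere; a *contravariant pair* $(E,\Lambda)$ consists of a smooth vector field $E$ and a smooth 2-vector field $\Lambda$ of constant rank $2s$, $0\le s\le n$, such that $E\wedge\Lambda^s$ vanishes nowhere. The pairs are *regular* if $\omega\wedge\Omega^n$, respectively $E\wedge\Lambda^n$, vanishes nowhere. Put $\Omega^\flat(X)=i_X\Omega$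 and $\Lambda^\sharp(\alpha)=i_\alpha\Lambda$, and for a 2-form $\theta$ let $(\Lambda^\sharp\otimes\Lambda^\sharp)(\theta)$ be the 2-vector field $(\alpha,\beta)\mapsto\theta(\Lambda^\sharp\alpha,\Lambda^\sharp\beta)$. The pairs $(\omega,\Omega)$ and $(E,\Lambda)$ are *mutually dual* if both are regular, $\Omega^\flat$ and $\Lambda^\sharp$ restrict to mutually inverse isomorphisms between $\operatorname{im}\Lambda^\sharp$ and $\operatorname{im}\Omega^\flat$, and $i_E\Omega=0$, $i_\omega\Lambda=0$, $i_E\omega=1$. A covariant pair $(\omega,\Omega)$ with $\omega\wedge\Omega^n$ nowhere zero is *almost-cosymplectic-contact* if $d\Omega=0$, *cosymplectic* if $d\omega=0$ and $d\Omega=0$, and *contact* if $\Omega=d\omega$. A contravariant pair $(E,\Lambda)$ is *coPoisson* if $[E,\Lambda]=0$ and $[\Lambda,\Lambda]=0$, and *Jacobi* if $[E,\Lambda]=0$ and $[\Lambda,\Lambda]=-2\,E\wedge\Lambda$. A triple $(E,\Lambda,\omega)$, with $(E,\Lambda)$ a contravariant pair and $\omega$ a smooth 1-form, is *almost-coPoisson-Jacobi*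 if $$[E,\Lambda]=-E\wedge\Lambda^\sharp(L_E\omega),\quad[\Lambda,\Lambda]=2\,E\wedge(\Lambda^\sharp\otimes\Lambda^\sharp)(d\omega),\quad i_E\omega=1,\quad i_\omega\Lambda=0.$$ **Theorem.** Let $(\omega,\Omega)$ and $(E,\Lambda)$ be mutually dual pairs on $M$. Then: (1) $(\omega,\Omega)$ is almost-cosymplectic-contact if and only if $(E,\Lambda,\omega)$ is almost-coPoisson-Jacobi; (2) $(\omega,\Omega)$ is cosymplectic if and only if $(E,\Lambda)$ is coPoisson; (3) $(\omega,\Omega)$ is contact if and only if $(E,\Lambda)$ is Jacobi. -/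

import Mathlib

open scoped Manifold

noncomputable section

namespace GeneralizedStructures

/-! ### Multilinear algebra on a tangent space

A `k`-form on a vector space `W` is an alternating `k`-linear form on `W`; a `k`-vector on a finite
dimensional `W` is an alternating `k`-linear form on the dual of `W`, the decomposable
`X₁ ∧ … ∧ X_k` being `(α₁, …, α_k) ↦ det (α_i X_j)`.  Thus `i_{α ∧ β} Λ = Λ(α, β)`. -/

section Algebra

variable {W W' : Type*} [AddCommGroup W] [Module ℝ W] [TopologicalSpace W]
  [AddCommGroup W'] [Module ℝ W'] [TopologicalSpace W']

/-- The space of `k`-vectors on `W`. -/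
abbrev MultiVec (k : ℕ) (W : Type*) [AddCommGroup W] [Module ℝ W] [TopologicalSpace W] :
    Type _ :=
  (W →L[ℝ] ℝ) [⋀^Fin k]→L[ℝ] ℝ

/-- Push-forward of a `k`-vector along a linear map `L`: `(L_* P)(α₁, …) = P(α₁ ∘ L, …)`. -/
def MultiVec.push {k : ℕ} [IsTopologicalAddGroup W] [IsTopologicalAddGroup W']
    (L : W →L[ℝ] W') (P : MultiVec k W) : MultiVec k W' :=
  P.compContinuousLinearMap (ContinuousLinearMap.precomp ℝ L)

/-- The exterior product of alternating forms, normalized as a sum over shuffles: for covectors,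
`(α ∧ β)(u, v) = α u * β v - α v * β u`. -/
def wedge {U : Type*} [AddCommGroup U] [Module ℝ U] {k l : ℕ}
    (a : U [⋀^Fin k]→ₗ[ℝ] ℝ) (b : U [⋀^Fin l]→ₗ[ℝ] ℝ) : U [⋀^Fin (k + l)]→ₗ[ℝ] ℝ :=
  ((LinearMap.mul' ℝ ℝ).compAlternatingMap (a.domCoprod b)).domDomCongr finSumFinEquiv

/-- The `r`-th exterior power of a 2-form (or of a 2-vector). -/
def wedgePow {U : Type*} [AddCommGroup U] [Module ℝ U] (a : U [⋀^Fin 2]→ₗ[ℝ] ℝ) :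
    (r : ℕ) → U [⋀^Fin (2 * r)]→ₗ[ℝ] ℝ
  | 0 => AlternatingMap.constOfIsEmpty ℝ U (Fin 0) 1
  | r + 1 => wedge (wedgePow a r) a

/-- A linear form regarded as an alternating form of degree one. -/
def one {U : Type*} [AddCommGroup U] [Module ℝ U] (f : U →ₗ[ℝ] ℝ) : U [⋀^Fin 1]→ₗ[ℝ] ℝ :=
  AlternatingMap.ofSubsingleton ℝ U ℝ (0 : Fin 1) f

/-- A vector regarded as an alternating form of degree one on the dual space. -/
def vecOne (X : W) : (W →L[ℝ] ℝ) [⋀^Fin 1]→ₗ[ℝ] ℝ :=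
  one { toFun := fun α => α X, map_add' := fun _ _ => rfl, map_smul' := fun _ _ => rfl }

section Bilinear

variable {U : Type*} [AddCommGroup U] [Module ℝ U] [TopologicalSpace U] (P : U [⋀^Fin 2]→L[ℝ] ℝ)

theorem bivec_add_left (a a' b : U) : P ![a + a', b] = P ![a, b] + P ![a', b] :=
  P.toMultilinearMap.cons_add ![b] a a'

theorem bivec_smul_left (c : ℝ) (a b : U) : P ![c • a, b] = c * P ![a, b] :=
  P.toMultilinearMap.cons_smul ![b] c a

theorem bivec_self (a : U) : P ![a, a] = 0 :=
  P.map_eq_zero_of_eq ![a, a] (i := 0) (j := 1) rfl (by decide)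

theorem bivec_swap (a b : U) : P ![a, b] = -P ![b, a] := by
  have h := P.map_swap ![b, a] (i := 0) (j := 1) (by decide)
  refine Eq.trans ?_ h
  change P _ = P _
  congr 1
  ext i; fin_cases i <;> rfl

theorem bivec_add_right (a b b' : U) : P ![a, b + b'] = P ![a, b] + P ![a, b'] := by
  rw [bivec_swap, bivec_add_left, bivec_swap P b a, bivec_swap P b' a]; ring

theorem bivec_smul_right (c : ℝ) (a b : U) : P ![a, c • b] = c * P ![a, b] := by
  rw [bivec_swap, bivec_smul_left, bivec_swap P b a]; ring

theorem bivec_zero_left (b : U) : P ![0, b] = 0 := by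
  simpa using bivec_smul_left P 0 0 b

theorem bivec_neg_left (a b : U) : P ![-a, b] = -P ![a, b] := by
  simpa using bivec_smul_left P (-1) a b

end Bilinear

/-- `Ω^♭ : X ↦ i_X Ω = Ω(X, ·)`. -/
def flat (Ω : W [⋀^Fin 2]→L[ℝ] ℝ) : W →ₗ[ℝ] (W →L[ℝ] ℝ) where
  toFun X :=
    { toFun := fun Y => Ω ![X, Y]
      map_add' := bivec_add_right Ω X
      map_smul' := fun c Y => bivec_smul_right Ω c X Y
      cont := Ω.cont.comp (continuous_pi fun i => by
        fin_cases i
        · exact continuous_const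
        · exact continuous_id) }
  map_add' X Y := by ext v; exact bivec_add_left Ω X Y v
  map_smul' c X := by ext v; exact bivec_smul_left Ω c X v

theorem flat_apply (Ω : W [⋀^Fin 2]→L[ℝ] ℝ) (X Y : W) : flat Ω X Y = Ω ![X, Y] := rfl

/-- `Λ^♯ : α ↦ i_α Λ = Λ(α, ·)`, where the linear form `Λ(α, ·)` on the dual of the finite
dimensional space `W` is identified with a vector of `W`. -/
def sharp [IsTopologicalAddGroup W] [ContinuousSMul ℝ W] [T2Space W] [FiniteDimensional ℝ W]
    (Λ : MultiVec 2 W) : (W →L[ℝ] ℝ) →ₗ[ℝ] W :=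
  (Module.evalEquiv ℝ W).symm.toLinearMap ∘ₗ
    ((LinearMap.toContinuousLinearMap : (W →ₗ[ℝ] ℝ) ≃ₗ[ℝ] (W →L[ℝ] ℝ)).toLinearMap.lcomp ℝ ℝ) ∘ₗ
      (ContinuousLinearMap.coeLM ℝ) ∘ₗ flat Λ

theorem apply_sharp [IsTopologicalAddGroup W] [ContinuousSMul ℝ W] [T2Space W]
    [FiniteDimensional ℝ W] (Λ : MultiVec 2 W) (α β : W →L[ℝ] ℝ) :
    β (sharp Λ α) = Λ ![α, β] := by
  have h := Module.apply_evalEquiv_symm_apply (R := ℝ) (M := W) (β : W →ₗ[ℝ] ℝ)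
    (((LinearMap.toContinuousLinearMap : (W →ₗ[ℝ] ℝ) ≃ₗ[ℝ] (W →L[ℝ] ℝ)).toLinearMap.lcomp ℝ ℝ)
      (flat Λ α : (W →L[ℝ] ℝ) →ₗ[ℝ] ℝ))
  refine h.trans ?_
  rw [← flat_apply]
  rfl

/-- `(Λ^♯ ⊗ Λ^♯)(θ)` for a 2-form `θ`: the 2-vector sending `μ ∧ ν` to `μ^♯ ∧ ν^♯`, that is,
`(α, β) ↦ θ(Λ^♯ α, Λ^♯ β)` (the two sign changes from the skew-symmetry of `Λ` cancel). -/
def sharpTensor [IsTopologicalAddGroup W] [ContinuousSMul ℝ W] [T2Space W] [FiniteDimensional ℝ W]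
    (Λ : MultiVec 2 W) (θ : W [⋀^Fin 2]→L[ℝ] ℝ) : (W →L[ℝ] ℝ) [⋀^Fin 2]→ₗ[ℝ] ℝ :=
  θ.toAlternatingMap.compLinearMap (sharp Λ)

end Algebra

/-! ### Differential calculus on a vector space -/

section Calculus

variable {V : Type*} [NormedAddCommGroup V] [NormedSpace ℝ V]

/-- The Lie derivative `L_X ω` of a 1-form: `(L_X ω)(v) = (D_X ω)(v) + ω (D_v X)`. -/
def lieDerivCovector (X : V → V) (ω : V → V →L[ℝ] ℝ) (y : V) : V →L[ℝ] ℝ :=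
  fderiv ℝ ω y (X y) + (ω y).comp (fderiv ℝ X y)

/-- The Schouten bracket `[X, P]` of a vector field and a 2-vector field, i.e. the Lie derivative
`L_X P`.  For constant (hence closed) `α`, `β` it is
`i_{[X, P]} (α ∧ β) = i_X d (i_P (α ∧ β)) - i_P d (i_X (α ∧ β))
  = X (P(α, β)) - P(d(α X), β) - P(α, d(β X))`. -/
def schoutenVec (X : V → V) (P : V → MultiVec 2 V) (y : V) :
    (V →L[ℝ] ℝ) [⋀^Fin 2]→ₗ[ℝ] ℝ where
  toFun a := fderiv ℝ P y (X y) ![a 0, a 1]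
    - P y ![(a 0).comp (fderiv ℝ X y), a 1] - P y ![a 0, (a 1).comp (fderiv ℝ X y)]
  map_update_add' := by
    intro dec a i x z
    rw [Subsingleton.elim dec (instDecidableEqFin 2)]
    fin_cases i <;>
      simp [Function.update, ContinuousLinearMap.add_comp, bivec_add_left, bivec_add_right] <;> ring
  map_update_smul' := by
    intro dec a i c x
    rw [Subsingleton.elim dec (instDecidableEqFin 2)]
    fin_cases i <;>
      simp [Function.update, ContinuousLinearMap.smul_comp, bivec_smul_left, bivec_smul_right] <;>
      ring
  map_eq_zero_of_eq' := by
    intro a i j h hij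
    have h01 : a 0 = a 1 := by
      fin_cases i <;> fin_cases j <;> simp_all
    simp only [h01, bivec_self]
    rw [bivec_swap (P y) ((a 1).comp _)]
    ring

/-- The differential at `y` of the function `P(α, β)`, for constant `α`, `β`. -/
def diffPair (P : V → MultiVec 2 V) (y : V) (α β : V →L[ℝ] ℝ) : V →L[ℝ] ℝ :=
  (fderiv ℝ P y).flipAlternating ![α, β]

theorem diffPair_add_left (P : V → MultiVec 2 V) (y : V) (α α' β : V →L[ℝ] ℝ) :
    diffPair P y (α + α') β = diffPair P y α β + diffPair P y α' β := by
  ext v; exact bivec_add_left _ _ _ _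

theorem diffPair_add_right (P : V → MultiVec 2 V) (y : V) (α β β' : V →L[ℝ] ℝ) :
    diffPair P y α (β + β') = diffPair P y α β + diffPair P y α β' := by
  ext v; exact bivec_add_right _ _ _ _

theorem diffPair_smul_left (P : V → MultiVec 2 V) (y : V) (c : ℝ) (α β : V →L[ℝ] ℝ) :
    diffPair P y (c • α) β = c • diffPair P y α β := by
  ext v; exact bivec_smul_left _ _ _ _

theorem diffPair_smul_right (P : V → MultiVec 2 V) (y : V) (c : ℝ) (α β : V →L[ℝ] ℝ) :
    diffPair P y α (c • β) = c • diffPair P y α β := by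
  ext v; exact bivec_smul_right _ _ _ _

theorem diffPair_self (P : V → MultiVec 2 V) (y : V) (α : V →L[ℝ] ℝ) :
    diffPair P y α α = 0 := by
  ext v; exact bivec_self _ _

theorem diffPair_swap (P : V → MultiVec 2 V) (y : V) (α β : V →L[ℝ] ℝ) :
    diffPair P y α β = -diffPair P y β α := by
  ext v; exact bivec_swap _ _ _

theorem ne01 : (0 : Fin 3) ≠ 1 := by decide

theorem ne02 : (0 : Fin 3) ≠ 2 := by decide

theorem ne10 : (1 : Fin 3) ≠ 0 := by decide

theorem ne12 : (1 : Fin 3) ≠ 2 := by decide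

theorem ne20 : (2 : Fin 3) ≠ 0 := by decide

theorem ne21 : (2 : Fin 3) ≠ 1 := by decide

theorem upd_ne {k : ℕ} {U : Type*} [DecidableEq (Fin k)] {i j : Fin k} (hij : j ≠ i) (a : Fin k → U) (z : U) :
    Function.update a i z j = a j :=
  Function.update_of_ne hij z a

/-- The Schouten bracket `[P, Q]` of two 2-vector fields.  For constant (hence closed) `α`, `β`,
`γ` it is `i_{[P, Q]} (α ∧ β ∧ γ) = (i_P d i_Q + i_Q d i_P) (α ∧ β ∧ γ)`, where
`i_P (α ∧ β ∧ γ) = P(α, β) γ + P(β, γ) α + P(γ, α) β`. -/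
def schoutenBivec (P Q : V → MultiVec 2 V) (y : V) :
    (V →L[ℝ] ℝ) [⋀^Fin 3]→ₗ[ℝ] ℝ where
  toFun a :=
    (P y ![diffPair Q y (a 0) (a 1), a 2] + P y ![diffPair Q y (a 1) (a 2), a 0]
      + P y ![diffPair Q y (a 2) (a 0), a 1])
    + (Q y ![diffPair P y (a 0) (a 1), a 2] + Q y ![diffPair P y (a 1) (a 2), a 0]
      + Q y ![diffPair P y (a 2) (a 0), a 1])
  map_update_add' := by
    intro dec a i x z
    have key : i = 0 ∨ i = 1 ∨ i = 2 := by omega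
    rcases key with rfl | rfl | rfl <;>
      simp only [Function.update_self, upd_ne ne01,
        upd_ne ne02, upd_ne ne10,
        upd_ne ne12, upd_ne ne20,
        upd_ne ne21, bivec_add_left, bivec_add_right, diffPair_add_left,
        diffPair_add_right] <;> ring
  map_update_smul' := by
    intro dec a i c x
    have key : i = 0 ∨ i = 1 ∨ i = 2 := by omega
    rcases key with rfl | rfl | rfl <;>
      simp only [Function.update_self, upd_ne ne01,
        upd_ne ne02, upd_ne ne10,
        upd_ne ne12, upd_ne ne20,
        upd_ne ne21, bivec_smul_left, bivec_smul_right, diffPair_smul_left,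
        diffPair_smul_right, smul_eq_mul] <;> ring
  map_eq_zero_of_eq' := by
    intro a i j h hij
    have key : a 0 = a 1 ∨ a 1 = a 2 ∨ a 2 = a 0 := by
      fin_cases i <;> fin_cases j <;> simp_all
    rcases key with h | h | h <;> rw [h]
    · rw [diffPair_self, diffPair_self, diffPair_swap Q y (a 2) (a 1),
        diffPair_swap P y (a 2) (a 1)]
      simp [bivec_neg_left, bivec_zero_left]
    · rw [diffPair_self, diffPair_self, diffPair_swap Q y (a 2) (a 0),
        diffPair_swap P y (a 2) (a 0)]
      simp [bivec_neg_left, bivec_zero_left]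
    · rw [diffPair_self, diffPair_self, diffPair_swap Q y (a 0) (a 1),
        diffPair_swap P y (a 0) (a 1)]
      simp [bivec_neg_left, bivec_zero_left]

end Calculus

/-! ### Tensor fields on a `(2n+1)`-dimensional manifold -/

/-- The model space of `(2n+1)`-dimensional manifolds. -/
abbrev Model (n : ℕ) : Type := EuclideanSpace ℝ (Fin (2 * n + 1))

section Manifold

variable {n : ℕ} {M : Type*} [TopologicalSpace M] [ChartedSpace (Model n) M]

instance (x : M) : T2Space (TangentSpace 𝓘(ℝ, Model n) x) :=
  inferInstanceAs (T2Space (Model n))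

instance (x : M) : FiniteDimensional ℝ (TangentSpace 𝓘(ℝ, Model n) x) :=
  inferInstanceAs (FiniteDimensional ℝ (Model n))

variable (n M)

/-- (Not necessarily continuous) vector fields on `M`. -/
abbrev VecField : Type _ := (x : M) → TangentSpace 𝓘(ℝ, Model n) x

/-- (Not necessarily continuous) 1-forms on `M`. -/
abbrev OneForm : Type _ := (x : M) → TangentSpace 𝓘(ℝ, Model n) x →L[ℝ] ℝ

/-- (Not necessarily continuous) 2-forms on `M`. -/
abbrev TwoForm : Type _ := (x : M) → TangentSpace 𝓘(ℝ, Model n) x [⋀^Fin 2]→L[ℝ] ℝ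

/-- (Not necessarily continuous) 2-vector fields on `M`. -/
abbrev BivecField : Type _ := (x : M) → MultiVec 2 (TangentSpace 𝓘(ℝ, Model n) x)

variable {n M}

/-- The differential at `p` of the preferred chart around `x`. -/
def dChart (x p : M) : TangentSpace 𝓘(ℝ, Model n) p →L[ℝ] Model n :=
  mfderiv 𝓘(ℝ, Model n) 𝓘(ℝ, Model n) (extChartAt 𝓘(ℝ, Model n) x) p

/-- The differential at `y` of the inverse of the preferred chart around `x`. -/
def dChartSymm (x : M) (y : Model n) :
    Model n →L[ℝ] TangentSpace 𝓘(ℝ, Model n) ((extChartAt 𝓘(ℝ, Model n) x).symm y) :=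
  mfderiv 𝓘(ℝ, Model n) 𝓘(ℝ, Model n) (extChartAt 𝓘(ℝ, Model n) x).symm y

/-! Coordinate representations of tensor fields in the preferred chart around `x`; they are
meaningful on the target of the chart. -/

/-- The representation of a vector field in the preferred chart around `x`. -/
def VecField.inChart (X : VecField n M) (x : M) (y : Model n) : Model n :=
  dChart x _ (X ((extChartAt 𝓘(ℝ, Model n) x).symm y))

/-- The representation of a 1-form in the preferred chart around `x`. -/
def OneForm.inChart (ω : OneForm n M) (x : M) (y : Model n) : Model n →L[ℝ] ℝ :=
  (ω ((extChartAt 𝓘(ℝ, Model n) x).symm y)).comp (dChartSymm x y)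

/-- The representation of a 2-form in the preferred chart around `x`. -/
def TwoForm.inChart (Ω : TwoForm n M) (x : M) (y : Model n) : Model n [⋀^Fin 2]→L[ℝ] ℝ :=
  (Ω ((extChartAt 𝓘(ℝ, Model n) x).symm y)).compContinuousLinearMap (dChartSymm x y)

/-- The representation of a 2-vector field in the preferred chart around `x`. -/
def BivecField.inChart (Λ : BivecField n M) (x : M) (y : Model n) : MultiVec 2 (Model n) :=
  (Λ ((extChartAt 𝓘(ℝ, Model n) x).symm y)).push (dChart x _)

/-- Smoothness of a vector field. -/
def VecField.Smooth [IsManifold 𝓘(ℝ, Model n) (⊤ : ℕ∞) M] (X : VecField n M) : Prop :=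
  ContMDiff 𝓘(ℝ, Model n) 𝓘(ℝ, Model n).tangent (⊤ : ℕ∞)
    (fun x => (⟨x, X x⟩ : TangentBundle 𝓘(ℝ, Model n) M))

/-- Smoothness of a 1-form: its coordinate representations are smooth. -/
def OneForm.Smooth (ω : OneForm n M) : Prop :=
  ∀ x : M, ContDiffOn ℝ (⊤ : ℕ∞) (ω.inChart x) (extChartAt 𝓘(ℝ, Model n) x).target

/-- Smoothness of a 2-form: its coordinate representations are smooth. -/
def TwoForm.Smooth (Ω : TwoForm n M) : Prop :=
  ∀ x : M, ContDiffOn ℝ (⊤ : ℕ∞) (Ω.inChart x) (extChartAt 𝓘(ℝ, Model n) x).target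

/-- Smoothness of a 2-vector field: its coordinate representations are smooth. -/
def BivecField.Smooth (Λ : BivecField n M) : Prop :=
  ∀ x : M, ContDiffOn ℝ (⊤ : ℕ∞) (Λ.inChart x) (extChartAt 𝓘(ℝ, Model n) x).target

/-! The differential operators below are natural, so at each point `x` they are computed in the
preferred chart around `x` and transported back to the tangent space at `x`. -/

/-- The exterior derivative `dω` of a 1-form, `dω(X, Y) = X (ω Y) - Y (ω X) - ω [X, Y]`. -/
def OneForm.d (ω : OneForm n M) (x : M) : TangentSpace 𝓘(ℝ, Model n) x [⋀^Fin 2]→L[ℝ] ℝ :=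
  (extDeriv (fun y => ContinuousAlternatingMap.ofSubsingleton ℝ (Model n) ℝ (0 : Fin 1)
    (ω.inChart x y)) (extChartAt 𝓘(ℝ, Model n) x x)).compContinuousLinearMap (dChart x x)

/-- The exterior derivative `dΩ` of a 2-form. -/
def TwoForm.d (Ω : TwoForm n M) (x : M) : TangentSpace 𝓘(ℝ, Model n) x [⋀^Fin 3]→L[ℝ] ℝ :=
  (extDeriv (Ω.inChart x) (extChartAt 𝓘(ℝ, Model n) x x)).compContinuousLinearMap (dChart x x)

/-- The Lie derivative `L_E ω` of a 1-form. -/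
def lieDeriv (E : VecField n M) (ω : OneForm n M) : OneForm n M := fun x =>
  (lieDerivCovector (E.inChart x) (ω.inChart x) (extChartAt 𝓘(ℝ, Model n) x x)).comp (dChart x x)

/-- The transport of a multivector of the model space to the tangent space at `x`, through the
inverse of the differential at `x` of the preferred chart around `x`. -/
def ofChart {k : ℕ} (x : M) (A : (Model n →L[ℝ] ℝ) [⋀^Fin k]→ₗ[ℝ] ℝ) :
    (TangentSpace 𝓘(ℝ, Model n) x →L[ℝ] ℝ) [⋀^Fin k]→ₗ[ℝ] ℝ :=
  A.compLinearMap (ContinuousLinearMap.precomp ℝ (dChart x x).inverse).toLinearMap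

/-- The Schouten bracket `[E, Λ]` of a vector field and a 2-vector field. -/
def bracketVec (E : VecField n M) (Λ : BivecField n M) (x : M) :
    (TangentSpace 𝓘(ℝ, Model n) x →L[ℝ] ℝ) [⋀^Fin 2]→ₗ[ℝ] ℝ :=
  ofChart x (schoutenVec (E.inChart x) (Λ.inChart x) (extChartAt 𝓘(ℝ, Model n) x x))

/-- The Schouten bracket `[Λ, Λ']` of two 2-vector fields. -/
def bracketBivec (Λ Λ' : BivecField n M) (x : M) :
    (TangentSpace 𝓘(ℝ, Model n) x →L[ℝ] ℝ) [⋀^Fin 3]→ₗ[ℝ] ℝ :=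
  ofChart x (schoutenBivec (Λ.inChart x) (Λ'.inChart x) (extChartAt 𝓘(ℝ, Model n) x x))

/-! ### Covariant and contravariant pairs -/

/-- `ω ∧ Ω^r` vanishes nowhere. -/
def OneForm.WedgeNeZero (ω : OneForm n M) (Ω : TwoForm n M) (r : ℕ) : Prop :=
  ∀ x, wedge (one (ω x).toLinearMap) (wedgePow (Ω x).toAlternatingMap r) ≠ 0

/-- `E ∧ Λ^s` vanishes nowhere. -/
def VecField.WedgeNeZero (E : VecField n M) (Λ : BivecField n M) (s : ℕ) : Prop :=
  ∀ x, wedge (vecOne (E x)) (wedgePow (Λ x).toAlternatingMap s) ≠ 0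

/-- `(ω, Ω)` is a covariant pair: `ω` is a smooth 1-form, `Ω` is a smooth 2-form of constant rank
`2r`, with `r ≤ n`, and `ω ∧ Ω^r` vanishes nowhere. -/
def IsCovariantPair (ω : OneForm n M) (Ω : TwoForm n M) : Prop :=
  ω.Smooth ∧ Ω.Smooth ∧
    ∃ r ≤ n, (∀ x, Module.finrank ℝ (LinearMap.range (flat (Ω x))) = 2 * r) ∧ ω.WedgeNeZero Ω r

/-- `(ω, Ω)` is a regular covariant pair. -/
def IsRegularCovariantPair (ω : OneForm n M) (Ω : TwoForm n M) : Prop :=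
  IsCovariantPair ω Ω ∧ ω.WedgeNeZero Ω n

variable [IsManifold 𝓘(ℝ, Model n) (⊤ : ℕ∞) M]

/-- `(E, Λ)` is a contravariant pair: `E` is a smooth vector field, `Λ` is a smooth 2-vector field
of constant rank `2s`, with `s ≤ n`, and `E ∧ Λ^s` vanishes nowhere. -/
def IsContravariantPair (E : VecField n M) (Λ : BivecField n M) : Prop :=
  E.Smooth ∧ Λ.Smooth ∧
    ∃ s ≤ n, (∀ x, Module.finrank ℝ (LinearMap.range (sharp (Λ x))) = 2 * s) ∧ E.WedgeNeZero Λ s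

/-- `(E, Λ)` is a regular contravariant pair. -/
def IsRegularContravariantPair (E : VecField n M) (Λ : BivecField n M) : Prop :=
  IsContravariantPair E Λ ∧ E.WedgeNeZero Λ n

/-- The pairs `(ω, Ω)` and `(E, Λ)` are mutually dual: they are regular, at each point `Ω^♭` and
`Λ^♯` restrict to mutually inverse isomorphisms between the images of `Λ^♯` and of `Ω^♭`, and
`i_E Ω = 0`, `i_ω Λ = 0`, `i_E ω = 1`. -/
structure MutuallyDual (ω : OneForm n M) (Ω : TwoForm n M) (E : VecField n M)
    (Λ : BivecField n M) : Prop where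
  regular_covariant : IsRegularCovariantPair ω Ω
  regular_contravariant : IsRegularContravariantPair E Λ
  inverse : ∀ x, ∃ e : LinearMap.range (sharp (Λ x)) ≃ₗ[ℝ] LinearMap.range (flat (Ω x)),
    (∀ X, (e X : TangentSpace 𝓘(ℝ, Model n) x →L[ℝ] ℝ) = flat (Ω x) X) ∧
    (∀ α, (e.symm α : TangentSpace 𝓘(ℝ, Model n) x) = sharp (Λ x) α)
  contract_Ω : ∀ x, flat (Ω x) (E x) = 0
  contract_Λ : ∀ x, sharp (Λ x) (ω x) = 0
  contract_ω : ∀ x, ω x (E x) = 1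

/-! ### Structures given by pairs -/

/-- `(ω, Ω)` is an almost-cosymplectic-contact pair. -/
def IsAlmostCosymplecticContact (ω : OneForm n M) (Ω : TwoForm n M) : Prop :=
  IsCovariantPair ω Ω ∧ (∀ x, Ω.d x = 0) ∧ ω.WedgeNeZero Ω n

/-- `(ω, Ω)` is a cosymplectic pair. -/
def IsCosymplectic (ω : OneForm n M) (Ω : TwoForm n M) : Prop :=
  IsCovariantPair ω Ω ∧ (∀ x, ω.d x = 0) ∧ (∀ x, Ω.d x = 0) ∧ ω.WedgeNeZero Ω n

/-- `(ω, Ω)` is a contact pair. -/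
def IsContact (ω : OneForm n M) (Ω : TwoForm n M) : Prop :=
  IsCovariantPair ω Ω ∧ (∀ x, Ω x = ω.d x) ∧ ω.WedgeNeZero Ω n

/-- `(E, Λ)` is a Jacobi pair: `[E, Λ] = 0` and `[Λ, Λ] = -2 E ∧ Λ`. -/
def IsJacobi (E : VecField n M) (Λ : BivecField n M) : Prop :=
  IsContravariantPair E Λ ∧ (∀ x, bracketVec E Λ x = 0) ∧
    ∀ x, bracketBivec Λ Λ x = -((2 : ℝ) • wedge (vecOne (E x)) (Λ x).toAlternatingMap)

/-- `(E, Λ)` is a coPoisson pair: `[E, Λ] = 0` and `[Λ, Λ] = 0`. -/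
def IsCoPoisson (E : VecField n M) (Λ : BivecField n M) : Prop :=
  IsContravariantPair E Λ ∧ (∀ x, bracketVec E Λ x = 0) ∧ ∀ x, bracketBivec Λ Λ x = 0

/-- `(E, Λ, ω)` is an almost-coPoisson-Jacobi 3-plet: `[E, Λ] = -E ∧ Λ^♯(L_E ω)`,
`[Λ, Λ] = 2 E ∧ (Λ^♯ ⊗ Λ^♯)(dω)`, `i_E ω = 1` and `i_ω Λ = 0`. -/
def IsAlmostCoPoissonJacobi (E : VecField n M) (Λ : BivecField n M) (ω : OneForm n M) : Prop :=
  IsContravariantPair E Λ ∧ ω.Smooth ∧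
    (∀ x, bracketVec E Λ x = -wedge (vecOne (E x)) (vecOne (sharp (Λ x) (lieDeriv E ω x)))) ∧
    (∀ x, bracketBivec Λ Λ x =
      (2 : ℝ) • wedge (vecOne (E x)) (sharpTensor (Λ x) (ω.d x))) ∧
    (∀ x, ω x (E x) = 1) ∧ ∀ x, sharp (Λ x) (ω x) = 0

end Manifold

end GeneralizedStructures

end

/-!
Everything is local, and at a point `x` every operator is computed in the preferred chart around
`x`, whose differential at `x` is the identity (`dChart_self`). In that chart the four tensors are
smooth fields on a vector space, dual to each other at every nearby point.

Duality on a single vector space says that `Λ^♯ ∘ Ω^♭` is the projection along `E` onto the kernel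
of `ω`, that is, `Λ(Ω^♭ v, β) = β(v) - ω(v) β(E)` (`PointwiseDual`). That `Ω^♭` has no kernel beyond
`ℝ E` is where `ω ∧ Ω^n ≠ 0` enters: a form of top degree killed by a nonzero vector vanishes
(`PointwiseDual.of_equiv`). Differentiating this relation, together with `i_E ω = 1`, `i_E Ω = 0`
and `i_ω Λ = 0`, expresses the derivative of `Λ` through those of `Ω` and `ω`
(`DualNear.fderiv_bivec`), and yields two identities valid for all mutually dual pairs:

* `[E, Λ] = (Λ^♯ ⊗ Λ^♯)(i_E dΩ) - E ∧ Λ^♯(L_E ω)` (`MutuallyDual.bracketVec_apply`),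
* `[Λ, Λ] = 2 E ∧ (Λ^♯ ⊗ Λ^♯)(dω) - 2 (Λ^♯ ⊗ Λ^♯ ⊗ Λ^♯)(dΩ)` (`MutuallyDual.bracketBivec_apply`).

Every tangent space is spanned by `E` and the image of `Λ^♯`, so the `dΩ` terms of both identities
vanish exactly when `dΩ = 0` (`MutuallyDual.d_eq_zero_iff`), which is the first equivalence.
Contracting the identities with `ω` removes the `dΩ` terms and leaves `Λ^♯(L_E ω)` and
`(Λ^♯ ⊗ Λ^♯)(dω)`; as `L_E ω = i_E dω`, the brackets thus determine `dω`. This gives `dω = 0` for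
coPoisson pairs and `dω = Ω` for Jacobi pairs. That contact pairs are Jacobi also needs that
exact 2-forms are closed, hence that `d` is compatible with changes of charts (`OneForm.inChart_d`).
-/

open scoped Manifold

noncomputable section

namespace GeneralizedStructures

open scoped Topology

/-! ### Exterior products in low degree, and top-degree forms -/

section Wedge

variable {U : Type*} [AddCommGroup U] [Module ℝ U]

theorem alternating_one_apply (f : U →ₗ[ℝ] ℝ) (v : Fin 1 → U) : one f v = f (v 0) := rfl

/-- `a ∧ b` as a sum over all permutations: each shuffle is counted `k! l!` times. -/
theorem factorial_mul_wedge_apply {k l : ℕ} (a : U [⋀^Fin k]→ₗ[ℝ] ℝ) (b : U [⋀^Fin l]→ₗ[ℝ] ℝ)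
    (v : Fin (k + l) → U) :
    ((k.factorial * l.factorial : ℕ) : ℝ) * wedge a b v =
      ∑ σ : Equiv.Perm (Fin (k + l)), (Equiv.Perm.sign σ : ℝ) *
        (a (fun i => v (σ (Fin.castAdd l i))) * b (fun j => v (σ (Fin.natAdd k j)))) := by
  have h := congrArg (fun f => (LinearMap.mul' ℝ ℝ) (f (v ∘ finSumFinEquiv)))
    (MultilinearMap.domCoprod_alternization_eq a b)
  simp only [MultilinearMap.alternatization_apply, map_sum, AlternatingMap.smul_apply,
    Fintype.card_fin] at h
  rw [map_nsmul, nsmul_eq_mul] at h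
  refine Eq.trans h.symm ?_
  refine Fintype.sum_equiv (Equiv.permCongr finSumFinEquiv) _ _ fun σ => ?_
  have hs : Equiv.Perm.sign ((Equiv.permCongr finSumFinEquiv) σ) = Equiv.Perm.sign σ :=
    Equiv.Perm.sign_permCongr _ _
  rw [hs, Units.smul_def, map_zsmul, zsmul_eq_mul]
  simp [Function.comp_def]

theorem wedge_one_one_apply (f g : U →ₗ[ℝ] ℝ) (v : Fin 2 → U) :
    wedge (one f) (one g) v = f (v 0) * g (v 1) - f (v 1) * g (v 0) := by
  have h := factorial_mul_wedge_apply (one f) (one g) v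
  have hu : (Finset.univ : Finset (Equiv.Perm (Fin (1 + 1)))) =
      {1, Equiv.swap 0 1} := by decide
  rw [hu, Finset.sum_pair (by decide)] at h
  simpa [alternating_one_apply, sub_eq_add_neg] using! h

theorem alternating_two_swap (b : U [⋀^Fin 2]→ₗ[ℝ] ℝ) (x y : U) : b ![x, y] = -b ![y, x] := by
  have h := b.map_swap ![y, x] (i := 0) (j := 1) (by decide)
  rw [← h]
  congr 1
  ext i; fin_cases i <;> rfl

theorem wedge_one_two_apply (f : U →ₗ[ℝ] ℝ) (b : U [⋀^Fin 2]→ₗ[ℝ] ℝ) (v : Fin 3 → U) :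
    wedge (one f) b v =
      f (v 0) * b ![v 1, v 2] + f (v 1) * b ![v 2, v 0] + f (v 2) * b ![v 0, v 1] := by
  have h := factorial_mul_wedge_apply (one f) b v
  have hu : (Finset.univ : Finset (Equiv.Perm (Fin (1 + 2)))) =
      {1, Equiv.swap 0 1, Equiv.swap 0 2, Equiv.swap 1 2, Equiv.swap 0 1 * Equiv.swap 1 2,
        Equiv.swap 0 2 * Equiv.swap 1 2} := by decide
  have hs (σ : Equiv.Perm (Fin (1 + 2))) :
      (fun j => v (σ (Fin.natAdd 1 j))) = ![v (σ 1), v (σ 2)] := by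
    ext j; fin_cases j <;> rfl
  have e1 : (Equiv.swap 0 1 : Equiv.Perm (Fin (1 + 2))) 2 = 2 := by decide
  have e2 : (Equiv.swap 0 2 : Equiv.Perm (Fin (1 + 2))) 1 = 1 := by decide
  have e3 : (Equiv.swap 1 2 : Equiv.Perm (Fin (1 + 2))) 0 = 0 := by decide
  simp only [hs, alternating_one_apply] at h
  rw [hu, Finset.sum_insert (by decide), Finset.sum_insert (by decide),
    Finset.sum_insert (by decide), Finset.sum_insert (by decide), Finset.sum_insert (by decide),
    Finset.sum_singleton] at h
  have hc : (Fin.castAdd 2 (0 : Fin 1)) = 0 := rfl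
  simp [hc, e1, e2, e3] at h
  rw [alternating_two_swap b (v 2) (v 1), alternating_two_swap b (v 0) (v 2),
    alternating_two_swap b (v 1) (v 0)] at h
  linarith
/-- If all contractions of `a` and of `b` with `X` vanish, so do those of `a ∧ b`. -/
theorem wedge_eq_zero_of_mem {k l : ℕ} {a : U [⋀^Fin k]→ₗ[ℝ] ℝ} {b : U [⋀^Fin l]→ₗ[ℝ] ℝ} {X : U}
    (ha : ∀ v, X ∈ Set.range v → a v = 0) (hb : ∀ v, X ∈ Set.range v → b v = 0)
    (v : Fin (k + l) → U) (hv : X ∈ Set.range v) : wedge a b v = 0 := by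
  have h := factorial_mul_wedge_apply a b v
  rw [Finset.sum_eq_zero] at h
  · refine (mul_eq_zero.mp h).resolve_left ?_
    exact_mod_cast (Nat.mul_pos k.factorial_pos l.factorial_pos).ne'
  · intro σ _
    obtain ⟨i, rfl⟩ := hv
    have hi : ∃ j, σ j = i := σ.surjective i
    obtain ⟨j, rfl⟩ := hi
    induction j using Fin.addCases with
    | left j => rw [ha _ ⟨j, rfl⟩, zero_mul, mul_zero]
    | right j => rw [hb _ ⟨j, rfl⟩, mul_zero, mul_zero]

theorem wedgePow_eq_zero_of_mem {a : U [⋀^Fin 2]→ₗ[ℝ] ℝ} {X : U}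
    (ha : ∀ v, X ∈ Set.range v → a v = 0) (r : ℕ) (v : Fin (2 * r) → U) (hv : X ∈ Set.range v) :
    wedgePow a r v = 0 := by
  induction r with
  | zero => exact (hv.choose).elim0
  | succ r ih => exact wedge_eq_zero_of_mem ih ha v hv

/-- A form of top degree with a nonzero vector in its kernel vanishes. -/
theorem alternating_eq_zero_of_mem [FiniteDimensional ℝ U] {k : ℕ} (hk : Module.finrank ℝ U = k)
    {a : U [⋀^Fin k]→ₗ[ℝ] ℝ} {X : U} (hX : X ≠ 0) (ha : ∀ v, X ∈ Set.range v → a v = 0) :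
    a = 0 := by
  have hli : LinearIndepOn ℝ id ({X} : Set U) := LinearIndepOn.singleton hX
  let B := Module.Basis.extend hli
  -- On a basis through `X`, an injective family of `k` basis vectors contains `X`.
  refine B.ext_alternating fun v hv => ?_
  have hmem : X ∈ hli.extend (Set.subset_univ _) := hli.subset_extend _ rfl
  have := FiniteDimensional.fintypeBasisIndex B
  have hcard : Fintype.card (Fin k) =
      Fintype.card (hli.extend (Set.subset_univ ({X} : Set U))) := by
    rw [Fintype.card_fin, ← hk, Module.finrank_eq_card_basis B]
  obtain ⟨i, hi⟩ := ((Fintype.bijective_iff_injective_and_card v).2 ⟨hv, hcard⟩).2 ⟨X, hmem⟩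
  rw [AlternatingMap.zero_apply]
  refine ha _ ⟨i, ?_⟩
  simp [hi, B]

end Wedge

/-! ### Dual tensors on a vector space -/

section PointwiseDual

variable {W : Type*} [AddCommGroup W] [Module ℝ W] [TopologicalSpace W]

/-- Duality of `(w, Θ)` and `(e, P)` on a single vector space, in the form in which it is
differentiated: `P^♯ ∘ Θ^♭` is the projection along `e` onto the kernel of `w`. -/
structure PointwiseDual (w : W →L[ℝ] ℝ) (Θ : W [⋀^Fin 2]→L[ℝ] ℝ) (e : W) (P : MultiVec 2 W) :
    Prop where
  pairing : w e = 1
  form_left : ∀ v, Θ ![e, v] = 0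
  bivec_left : ∀ b, P ![w, b] = 0
  bivec_flat : ∀ v b, P ![flat Θ v, b] = b v - w v * b e

theorem eq_of_forall_clm [IsTopologicalAddGroup W] [ContinuousSMul ℝ W] [T2Space W]
    [FiniteDimensional ℝ W] {u v : W} (h : ∀ b : W →L[ℝ] ℝ, b u = b v) : u = v := by
  rw [← sub_eq_zero]
  refine (Module.forall_dual_apply_eq_zero_iff ℝ _).1 fun f => ?_
  have := h (LinearMap.toContinuousLinearMap f)
  rw [map_sub, sub_eq_zero]
  exact this

namespace PointwiseDual

variable {w : W →L[ℝ] ℝ} {Θ : W [⋀^Fin 2]→L[ℝ] ℝ} {e : W} {P : MultiVec 2 W}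

theorem bivec_right (h : PointwiseDual w Θ e P) (b : W →L[ℝ] ℝ) : P ![b, w] = 0 := by
  rw [bivec_swap, h.bivec_left, neg_zero]

variable [IsTopologicalAddGroup W] [ContinuousSMul ℝ W] [T2Space W] [FiniteDimensional ℝ W]

theorem apply_sharp_eq_zero (h : PointwiseDual w Θ e P) (a : W →L[ℝ] ℝ) : w (sharp P a) = 0 := by
  rw [apply_sharp, h.bivec_right]

theorem sharp_self (h : PointwiseDual w Θ e P) : sharp P w = 0 :=
  eq_of_forall_clm fun b => by rw [apply_sharp, h.bivec_left, map_zero]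

/-- `Θ^♭ ∘ P^♯` is the projection along `w` onto the annihilator of `e`. -/
theorem form_sharp (h : PointwiseDual w Θ e P) (a : W →L[ℝ] ℝ) (v : W) :
    Θ ![sharp P a, v] = a v - a e * w v := by
  rw [bivec_swap, ← flat_apply, apply_sharp, bivec_swap, neg_neg, h.bivec_flat]
  ring

theorem sharp_flat (h : PointwiseDual w Θ e P) (v : W) :
    sharp P (flat Θ v) = v - w v • e :=
  eq_of_forall_clm fun b => by rw [apply_sharp, h.bivec_flat]; simp

theorem eq_sharp_add (h : PointwiseDual w Θ e P) (v : W) :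
    v = sharp P (flat Θ v) + w v • e := by
  rw [h.sharp_flat]; abel

theorem form_sharp_sharp (h : PointwiseDual w Θ e P) (a b : W →L[ℝ] ℝ) :
    Θ ![sharp P a, sharp P b] = -P ![a, b] := by
  rw [h.form_sharp, h.apply_sharp_eq_zero, apply_sharp, bivec_swap]; ring

/-- Duality in the sense of mutually inverse isomorphisms `Θ^♭` and `P^♯` between images; the
nonvanishing of `w ∧ Θ^n` in top degree makes the kernels of `w` and `Θ^♭` complementary. -/
theorem of_equiv {n : ℕ} (hn : Module.finrank ℝ W = 1 + 2 * n)
    (hreg : wedge (one w.toLinearMap) (wedgePow Θ.toAlternatingMap n) ≠ 0)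
    (hΘP : ∀ v, flat Θ (sharp P (flat Θ v)) = flat Θ v)
    (hΘ : flat Θ e = 0) (hP : sharp P w = 0) (hw : w e = 1) : PointwiseDual w Θ e P := by
  have hPl (b : W →L[ℝ] ℝ) : P ![w, b] = 0 := by rw [← apply_sharp, hP, map_zero]
  refine ⟨hw, fun v => by rw [← flat_apply, hΘ]; rfl, hPl, fun v b => ?_⟩
  -- Such an `X` kills both `w` and `Θ`, hence the top-degree form `w ∧ Θ^n`.
  have hker (X : W) (hX : flat Θ X = 0) (hX' : w X = 0) : X = 0 := by
    by_contra hne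
    refine hreg (alternating_eq_zero_of_mem hn hne fun v hv => wedge_eq_zero_of_mem ?_ ?_ v hv)
    · rintro v ⟨i, rfl⟩
      rw [Subsingleton.elim i 0] at hX'
      exact hX'
    · refine wedgePow_eq_zero_of_mem ?_ n
      rintro v ⟨i, rfl⟩
      have hv : v = ![v 0, v 1] := by ext j; fin_cases j <;> rfl
      have h0 (u : W) : Θ ![v i, u] = 0 := by rw [← flat_apply, hX]; rfl
      change Θ v = 0
      rw [hv]
      fin_cases i
      · exact h0 _
      · rw [bivec_swap]; exact neg_eq_zero.2 (h0 _)
  -- `P^♯ Θ^♭ v` and `v - w(v) e` both lie in the kernel of `w` and have the same image under `Θ^♭`.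
  have hz := hker (sharp P (flat Θ v) - (v - w v • e)) (by simp [hΘP, hΘ])
    (by rw [map_sub, apply_sharp, bivec_swap, hPl]; simp [hw])
  rw [← apply_sharp, sub_eq_zero.1 hz]
  simp

end PointwiseDual

section Transport

variable {W' : Type*} [AddCommGroup W'] [Module ℝ W'] [TopologicalSpace W']

theorem push_apply [IsTopologicalAddGroup W] [IsTopologicalAddGroup W'] 
    (L : W →L[ℝ] W') (P : MultiVec 2 W) (a b : W' →L[ℝ] ℝ) :
    P.push L ![a, b] = P ![a.comp L, b.comp L] := by
  change P _ = P _
  congr 1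
  ext i; fin_cases i <;> rfl

theorem compContinuousLinearMap_pair (L : W' →L[ℝ] W) (Θ : W [⋀^Fin 2]→L[ℝ] ℝ) (u v : W') :
    Θ.compContinuousLinearMap L ![u, v] = Θ ![L u, L v] := by
  change Θ _ = Θ _
  congr 1
  ext i; fin_cases i <;> rfl

theorem PointwiseDual.transport [IsTopologicalAddGroup W] [IsTopologicalAddGroup W']
    {w : W →L[ℝ] ℝ} {Θ : W [⋀^Fin 2]→L[ℝ] ℝ} {e : W} {P : MultiVec 2 W} 
    (h : PointwiseDual w Θ e P) (A : W →L[ℝ] W') (B : W' →L[ℝ] W)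
    (hAB : A.comp B = ContinuousLinearMap.id ℝ W') (hBA : B.comp A = ContinuousLinearMap.id ℝ W) :
    PointwiseDual (w.comp B) (Θ.compContinuousLinearMap B) (A e) (P.push A) := by
  have hAB' (v : W') : A (B v) = v := DFunLike.congr_fun hAB v
  have hBA' (v : W) : B (A v) = v := DFunLike.congr_fun hBA v
  refine ⟨by simp [hBA', h.pairing], fun v => ?_, fun b => ?_, fun v b => ?_⟩
  · rw [compContinuousLinearMap_pair, hBA', h.form_left]
  · rw [push_apply, ContinuousLinearMap.comp_assoc, hBA]
    exact h.bivec_left _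
  · have hf : (flat (Θ.compContinuousLinearMap B) v).comp A = flat Θ (B v) := by
      ext u
      rw [ContinuousLinearMap.comp_apply, flat_apply, compContinuousLinearMap_pair, hBA',
        flat_apply]
    rw [push_apply, hf, h.bivec_flat]
    simp [hAB']

end Transport

end PointwiseDual

/-! ### Derivatives of dual fields -/

section Calculus

variable {V : Type*} [NormedAddCommGroup V] [NormedSpace ℝ V]

theorem fderiv_bivec_apply {F : Type*} [NormedAddCommGroup F] [NormedSpace ℝ F]
    {Θ : V → F [⋀^Fin 2]→L[ℝ] ℝ} {a b : V → F} {y : V}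
    (hΘ : DifferentiableAt ℝ Θ y) (ha : DifferentiableAt ℝ a y) (hb : DifferentiableAt ℝ b y)
    (u : V) :
    fderiv ℝ (fun z => Θ z ![a z, b z]) y u =
      fderiv ℝ Θ y u ![a y, b y] + Θ y ![fderiv ℝ a y u, b y] + Θ y ![a y, fderiv ℝ b y u] := by
  have hg : ∀ i : Fin 2, DifferentiableAt ℝ ((![a, b] : Fin 2 → V → F) i) y := by
    intro i; fin_cases i
    · exact ha
    · exact hb
  have hc (z : V) : (fun i => (![a, b] : Fin 2 → V → F) i z) = ![a z, b z] := by
    ext i; fin_cases i <;> rfl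
  have h := fderiv_continuousAlternatingMap_apply_apply hΘ hg u
  simp only [hc] at h
  rw [h, Fin.sum_univ_two, ← add_assoc]
  congr 2
  · congr 1
    ext i; fin_cases i <;> rfl
  · ext i; fin_cases i <;> rfl

/-- `Θ ↦ Θ^♭(v)` as a continuous linear map. -/
def flatCLM (v : V) : (V [⋀^Fin 2]→L[ℝ] ℝ) →L[ℝ] (V →L[ℝ] ℝ) :=
  LinearMap.mkContinuous
    { toFun := fun Θ => flat Θ v
      map_add' := fun _ _ => rfl
      map_smul' := fun _ _ => rfl } ‖v‖ fun Θ => by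
    refine ContinuousLinearMap.opNorm_le_bound _ (by positivity) fun u => ?_
    have h := Θ.le_opNorm ![v, u]
    rw [Fin.prod_univ_two] at h
    calc ‖Θ ![v, u]‖ ≤ ‖Θ‖ * (‖v‖ * ‖u‖) := h
      _ = ‖v‖ * ‖Θ‖ * ‖u‖ := by ring

theorem hasFDerivAt_flat {Θ : V → V [⋀^Fin 2]→L[ℝ] ℝ} {y : V} (hΘ : DifferentiableAt ℝ Θ y)
    (v : V) : HasFDerivAt (fun z => flat (Θ z) v) ((flatCLM v).comp (fderiv ℝ Θ y)) y :=
  (flatCLM v).hasFDerivAt.comp y hΘ.hasFDerivAt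

theorem fderiv_flat_apply {Θ : V → V [⋀^Fin 2]→L[ℝ] ℝ} {y : V} (hΘ : DifferentiableAt ℝ Θ y)
    (u v x : V) : fderiv ℝ (fun z => flat (Θ z) v) y u x = fderiv ℝ Θ y u ![v, x] := by
  rw [(hasFDerivAt_flat hΘ v).fderiv]
  rfl

variable {w : V → V →L[ℝ] ℝ} {Θ : V → V [⋀^Fin 2]→L[ℝ] ℝ} {e : V → V}
  {P : V → MultiVec 2 V} {y : V}

/-- Fields of tensors on a vector space, dual to each other at all points near `y` and
differentiable at `y`. -/
structure DualNear (w : V → V →L[ℝ] ℝ) (Θ : V → V [⋀^Fin 2]→L[ℝ] ℝ) (e : V → V)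
    (P : V → MultiVec 2 V) (y : V) : Prop where
  dual : ∀ᶠ z in 𝓝 y, PointwiseDual (w z) (Θ z) (e z) (P z)
  diff_w : DifferentiableAt ℝ w y
  diff_form : DifferentiableAt ℝ Θ y
  diff_e : DifferentiableAt ℝ e y
  diff_bivec : DifferentiableAt ℝ P y

namespace DualNear

theorem at_point (h : DualNear w Θ e P y) : PointwiseDual (w y) (Θ y) (e y) (P y) :=
  h.dual.self_of_nhds

/-- The derivative of `w(e) = 1`. -/
theorem fderiv_pairing (h : DualNear w Θ e P y) (u : V) :
    fderiv ℝ w y u (e y) + w y (fderiv ℝ e y u) = 0 := by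
  have h1 : (fun z => w z (e z)) =ᶠ[𝓝 y] fun _ => (1 : ℝ) := h.dual.mono fun z hz => hz.pairing
  have h2 := congrArg (fun f => f u) (fderiv_clm_apply h.diff_w h.diff_e)
  rw [h1.fderiv_eq] at h2
  simp at h2
  linarith

/-- The derivative of `i_e Θ = 0`. -/
theorem fderiv_form_left (h : DualNear w Θ e P y) (u v : V) :
    fderiv ℝ Θ y u ![e y, v] + Θ y ![fderiv ℝ e y u, v] = 0 := by
  have h1 : (fun z => Θ z ![e z, v]) =ᶠ[𝓝 y] fun _ => (0 : ℝ) :=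
    h.dual.mono fun z hz => hz.form_left v
  have h2 := fderiv_bivec_apply h.diff_form h.diff_e (differentiableAt_const v) u
  rw [h1.fderiv_eq] at h2
  have h3 := bivec_smul_right (Θ y) 0 (e y) 0
  simp at h2 h3
  rw [h3] at h2
  linarith

/-- The derivative of `i_w P = 0`. -/
theorem fderiv_bivec_left (h : DualNear w Θ e P y) (u : V) (b : V →L[ℝ] ℝ) :
    fderiv ℝ P y u ![w y, b] + P y ![fderiv ℝ w y u, b] = 0 := by
  have h1 : (fun z => P z ![w z, b]) =ᶠ[𝓝 y] fun _ => (0 : ℝ) :=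
    h.dual.mono fun z hz => hz.bivec_left b
  have h2 := fderiv_bivec_apply h.diff_bivec h.diff_w (differentiableAt_const b) u
  rw [h1.fderiv_eq] at h2
  have h3 := bivec_smul_right (P y) 0 (w y) 0
  simp at h2 h3
  rw [h3] at h2
  linarith

/-- The derivative of `P(Θ^♭ v, b) = b(v) - w(v) b(e)`. -/
theorem fderiv_bivec_flat (h : DualNear w Θ e P y) (u v : V) (b : V →L[ℝ] ℝ) :
    fderiv ℝ P y u ![flat (Θ y) v, b] + P y ![flat (fderiv ℝ Θ y u) v, b] =
      -(fderiv ℝ w y u v * b (e y) + w y v * b (fderiv ℝ e y u)) := by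
  have h1 : (fun z => P z ![flat (Θ z) v, b]) =ᶠ[𝓝 y] fun z => b v - w z v * b (e z) :=
    h.dual.mono fun z hz => hz.bivec_flat v b
  have h2 := fderiv_bivec_apply h.diff_bivec (hasFDerivAt_flat h.diff_form v).differentiableAt
    (differentiableAt_const b) u
  have h4 : HasFDerivAt (fun z => b v - w z v * b (e z))
      (-(w y v • b.comp (fderiv ℝ e y) + b (e y) • (fderiv ℝ w y).flip v)) y := by
    have hb : HasFDerivAt (fun z => b (e z)) (b.comp (fderiv ℝ e y)) y :=
      b.hasFDerivAt.comp y h.diff_e.hasFDerivAt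
    have hw : HasFDerivAt (fun z => w z v) ((fderiv ℝ w y).flip v) y := by
      simpa using h.diff_w.hasFDerivAt.clm_apply (hasFDerivAt_const v y)
    exact (hw.mul hb).const_sub _
  rw [h1.fderiv_eq, h4.fderiv] at h2
  have h3 := bivec_smul_right (P y) 0 (flat (Θ y) v) 0
  have h5 : fderiv ℝ (fun z => flat (Θ z) v) y u = flat (fderiv ℝ Θ y u) v := by
    ext x; exact fderiv_flat_apply h.diff_form u v x
  rw [h5] at h2
  simp at h2 h3
  rw [h3] at h2
  linarith

variable [FiniteDimensional ℝ V]

/-- The derivative of the bivector field is determined by those of the two forms. -/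
theorem fderiv_bivec (h : DualNear w Θ e P y) (u : V) (a b : V →L[ℝ] ℝ) :
    fderiv ℝ P y u ![a, b] =
      fderiv ℝ Θ y u ![sharp (P y) a, sharp (P y) b]
        + a (e y) * fderiv ℝ w y u (sharp (P y) b) - b (e y) * fderiv ℝ w y u (sharp (P y) a) := by
  have h1 := h.fderiv_bivec_flat u (sharp (P y) a) b
  have h2 := h.fderiv_bivec_left u b
  -- The derivative of `P(Θ^♭ v, b)` is used at the fixed vector `v = P^♯ a`, for which `w(v) = 0`.
  have hf : flat (Θ y) (sharp (P y) a) = a + (-a (e y)) • w y := by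
    ext v
    rw [flat_apply, h.at_point.form_sharp]
    simp; ring
  have h3 (c : V →L[ℝ] ℝ) : P y ![c, b] = -c (sharp (P y) b) := by
    rw [bivec_swap, apply_sharp]
  rw [hf, bivec_add_left, bivec_smul_left, h.at_point.apply_sharp_eq_zero, h3, flat_apply] at h1
  rw [h3] at h2
  linear_combination h1 + a (e y) * h2

end DualNear

theorem extDeriv_one_form_apply {w : V → V →L[ℝ] ℝ} {y : V} (hw : DifferentiableAt ℝ w y)
    (u v : V) :
    extDeriv (fun z => ContinuousAlternatingMap.ofSubsingleton ℝ V ℝ (0 : Fin 1) (w z)) y ![u, v] =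
      fderiv ℝ w y u v - fderiv ℝ w y v u := by
  have hd : DifferentiableAt ℝ
      (fun z => ContinuousAlternatingMap.ofSubsingleton ℝ V ℝ (0 : Fin 1) (w z)) y :=
    (ContinuousAlternatingMap.ofSubsingletonLIE (𝕜 := ℝ) (E := V) (F := ℝ)
      (0 : Fin 1)).toContinuousLinearEquiv.differentiableAt.comp y hw
  have hk (x : V) : fderiv ℝ (fun z => w z x) y = (fderiv ℝ w y).flip x := by
    simpa using (hw.hasFDerivAt.clm_apply (hasFDerivAt_const x y)).fderiv
  rw [extDeriv_apply hd, Fin.sum_univ_two]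
  simp [Fin.removeNth, hk, sub_eq_add_neg]

theorem extDeriv_two_form_apply {Θ : V → V [⋀^Fin 2]→L[ℝ] ℝ} {y : V} (u v x : V) :
    extDeriv Θ y ![u, v, x] =
      fderiv ℝ Θ y u ![v, x] + fderiv ℝ Θ y v ![x, u] + fderiv ℝ Θ y x ![u, v] := by
  rw [extDeriv, ContinuousAlternatingMap.alternatizeUncurryFin_apply, Fin.sum_univ_three]
  have h0 : (0 : Fin 3).removeNth ![u, v, x] = ![v, x] := by
    ext i; fin_cases i <;> rfl
  have h1 : (1 : Fin 3).removeNth ![u, v, x] = ![u, x] := by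
    ext i; fin_cases i <;> rfl
  have h2 : (2 : Fin 3).removeNth ![u, v, x] = ![u, v] := by
    ext i; fin_cases i <;> rfl
  rw [h0, h1, h2, bivec_swap _ u x]
  simp

theorem schoutenVec_apply (X : V → V) (P : V → MultiVec 2 V) (y : V) (a b : V →L[ℝ] ℝ) :
    schoutenVec X P y ![a, b] = fderiv ℝ P y (X y) ![a, b]
      - P y ![a.comp (fderiv ℝ X y), b] - P y ![a, b.comp (fderiv ℝ X y)] := rfl

theorem schoutenBivec_apply (P Q : V → MultiVec 2 V) (y : V) (a b c : V →L[ℝ] ℝ) :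
    schoutenBivec P Q y ![a, b, c] =
      (P y ![diffPair Q y a b, c] + P y ![diffPair Q y b c, a] + P y ![diffPair Q y c a, b])
      + (Q y ![diffPair P y a b, c] + Q y ![diffPair P y b c, a] + Q y ![diffPair P y c a, b]) :=
  rfl

namespace DualNear

/-- Cartan's formula `L_e w = i_e dw`, since `i_e w = 1`. -/
theorem lieDerivCovector_apply (h : DualNear w Θ e P y) (v : V) :
    lieDerivCovector e w y v =
      extDeriv (fun z => ContinuousAlternatingMap.ofSubsingleton ℝ V ℝ (0 : Fin 1) (w z)) y
        ![e y, v] := by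
  rw [extDeriv_one_form_apply h.diff_w]
  simp only [lieDerivCovector, _root_.add_apply, ContinuousLinearMap.comp_apply]
  linarith [h.fderiv_pairing v]

variable [FiniteDimensional ℝ V]

/-- `[e, P] = (P^♯ ⊗ P^♯)(i_e dΘ) - e ∧ P^♯(L_e w)`. -/
theorem schoutenVec_eq (h : DualNear w Θ e P y) (a b : V →L[ℝ] ℝ) :
    schoutenVec e P y ![a, b] = extDeriv Θ y ![e y, sharp (P y) a, sharp (P y) b]
      + a (e y) * lieDerivCovector e w y (sharp (P y) b)
      - b (e y) * lieDerivCovector e w y (sharp (P y) a) := by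
  have h3 (c d : V →L[ℝ] ℝ) : P y ![c, d] = -c (sharp (P y) d) := by
    rw [bivec_swap, apply_sharp]
  -- This turns `a(De(P^♯ b))` into `Θ(P^♯ a, De(P^♯ b))`, a term of the derivative of `i_e Θ = 0`.
  have h4 (c : V →L[ℝ] ℝ) (v : V) : c v = Θ y ![sharp (P y) c, v] + c (e y) * w y v := by
    rw [h.at_point.form_sharp]; ring
  rw [schoutenVec_apply, h.fderiv_bivec, extDeriv_two_form_apply, h3,
    ← apply_sharp (P y) a]
  simp only [lieDerivCovector, _root_.add_apply, ContinuousLinearMap.comp_apply]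
  rw [h4 a (fderiv ℝ e y _), h4 b (fderiv ℝ e y _), bivec_swap (Θ y) (sharp (P y) a),
    bivec_swap (Θ y) (sharp (P y) b)]
  have h5 := h.fderiv_form_left (sharp (P y) a) (sharp (P y) b)
  have h6 := h.fderiv_form_left (sharp (P y) b) (sharp (P y) a)
  rw [bivec_swap (fderiv ℝ Θ y (sharp (P y) a)) (sharp (P y) b)]
  linarith

/-- `½ [P, P] = e ∧ (P^♯ ⊗ P^♯)(dw) - (P^♯ ⊗ P^♯ ⊗ P^♯)(dΘ)`. -/
theorem schoutenBivec_eq (h : DualNear w Θ e P y) (a b c : V →L[ℝ] ℝ) :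
    schoutenBivec P P y ![a, b, c] =
      2 * (a (e y) *
        extDeriv (fun z => ContinuousAlternatingMap.ofSubsingleton ℝ V ℝ (0 : Fin 1) (w z)) y
          ![sharp (P y) b, sharp (P y) c]
      + b (e y) *
        extDeriv (fun z => ContinuousAlternatingMap.ofSubsingleton ℝ V ℝ (0 : Fin 1) (w z)) y
          ![sharp (P y) c, sharp (P y) a]
      + c (e y) *
        extDeriv (fun z => ContinuousAlternatingMap.ofSubsingleton ℝ V ℝ (0 : Fin 1) (w z)) y
          ![sharp (P y) a, sharp (P y) b]
      - extDeriv Θ y ![sharp (P y) a, sharp (P y) b, sharp (P y) c]) := by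
  have h3 (a b c : V →L[ℝ] ℝ) :
      P y ![diffPair P y a b, c] = -fderiv ℝ P y (sharp (P y) c) ![a, b] := by
    rw [bivec_swap, ← apply_sharp]
    rfl
  simp only [schoutenBivec_apply, h3, h.fderiv_bivec, extDeriv_one_form_apply h.diff_w,
    extDeriv_two_form_apply]
  ring

end DualNear

end Calculus

/-! ### Mutually dual pairs in the preferred charts -/

section Charts

variable {n : ℕ} {M : Type*} [TopologicalSpace M] [ChartedSpace (Model n) M]

theorem OneForm.Smooth.contDiffAt {ω : OneForm n M} (hω : ω.Smooth) (x : M) :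
    ContDiffAt ℝ (⊤ : ℕ∞) (ω.inChart x) (extChartAt 𝓘(ℝ, Model n) x x) :=
  (hω x).contDiffAt (extChartAt_target_mem_nhds x)

theorem TwoForm.Smooth.contDiffAt {Ω : TwoForm n M} (hΩ : Ω.Smooth) (x : M) :
    ContDiffAt ℝ (⊤ : ℕ∞) (Ω.inChart x) (extChartAt 𝓘(ℝ, Model n) x x) :=
  (hΩ x).contDiffAt (extChartAt_target_mem_nhds x)

theorem BivecField.Smooth.contDiffAt {Λ : BivecField n M} (hΛ : Λ.Smooth) (x : M) :
    ContDiffAt ℝ (⊤ : ℕ∞) (Λ.inChart x) (extChartAt 𝓘(ℝ, Model n) x x) :=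
  (hΛ x).contDiffAt (extChartAt_target_mem_nhds x)

variable [IsManifold 𝓘(ℝ, Model n) (⊤ : ℕ∞) M]

theorem isManifold_one : IsManifold 𝓘(ℝ, Model n) 1 M :=
  IsManifold.of_le (n := ((⊤ : ℕ∞) : WithTop ℕ∞)) (by exact_mod_cast le_top)

/-- The tangent space at `x` is by definition the model space, identified with it through the
preferred chart at `x`. -/
theorem dChart_self (x : M) : dChart x x = ContinuousLinearMap.id ℝ (Model n) := by
  have := isManifold_one (n := n) (M := M)
  exact mfderiv_extChartAt_self

theorem dChart_comp_dChartSymm (x : M) {y : Model n}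
    (hy : y ∈ (extChartAt 𝓘(ℝ, Model n) x).target) :
    (dChart x _).comp (dChartSymm x y) = ContinuousLinearMap.id ℝ (Model n) := by
  have := isManifold_one (n := n) (M := M)
  have h := mfderiv_extChartAt_comp_mfderivWithin_extChartAt_symm hy
  rw [ModelWithCorners.range_eq_univ, mfderivWithin_univ] at h
  exact h

theorem dChartSymm_comp_dChart (x : M) {y : Model n}
    (hy : y ∈ (extChartAt 𝓘(ℝ, Model n) x).target) :
    (dChartSymm x y).comp (dChart x _) = ContinuousLinearMap.id ℝ _ := by
  have := isManifold_one (n := n) (M := M)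
  have h := mfderivWithin_extChartAt_symm_comp_mfderiv_extChartAt hy
  rw [ModelWithCorners.range_eq_univ, mfderivWithin_univ] at h
  exact h

theorem VecField.inChart_self (E : VecField n M) (x : M) :
    E.inChart x (extChartAt 𝓘(ℝ, Model n) x x) = E x := by
  have h : ∀ p : M, p = x → (dChart x p (E p) : Model n) = E x := by
    rintro p rfl
    rw [dChart_self]
    rfl
  exact h _ (extChartAt_to_inv x)

theorem BivecField.inChart_self (Λ : BivecField n M) (x : M) :
    Λ.inChart x (extChartAt 𝓘(ℝ, Model n) x x) = Λ x := by
  have h : ∀ p : M, p = x → ((Λ p).push (dChart x p) : MultiVec 2 (Model n)) = Λ x := by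
    rintro p rfl
    rw [dChart_self]
    rfl
  exact h _ (extChartAt_to_inv x)

theorem VecField.differentiableAt_inChart {E : VecField n M} (hE : E.Smooth) (x : M) :
    DifferentiableAt ℝ (E.inChart x) (extChartAt 𝓘(ℝ, Model n) x x) := by
  have := isManifold_one (n := n) (M := M)
  have h1 := (Bundle.contMDiffAt_section x).1 (hE x)
  have h2 := (contMDiffAt_iff.1 h1).2
  rw [ModelWithCorners.range_eq_univ, contDiffWithinAt_univ] at h2
  refine (h2.differentiableAt (by simp)).congr_of_eventuallyEq ?_
  filter_upwards [extChartAt_target_mem_nhds (I := 𝓘(ℝ, Model n)) x] with y hy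
  have hy' : (extChartAt 𝓘(ℝ, Model n) x).symm y ∈ (chartAt (Model n) x).source := by
    rw [← extChartAt_source 𝓘(ℝ, Model n)]
    exact (extChartAt 𝓘(ℝ, Model n) x).map_target hy
  have h3 := TangentBundle.continuousLinearMapAt_trivializationAt (I := 𝓘(ℝ, Model n)) hy'
  rw [VecField.inChart, dChart, ← h3]
  exact Bundle.Trivialization.continuousLinearMapAt_apply_of_mem (R := ℝ)
    (trivializationAt (Model n) (TangentSpace 𝓘(ℝ, Model n)) x) hy' _

variable {ω : OneForm n M} {Ω : TwoForm n M} {E : VecField n M} {Λ : BivecField n M}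

theorem MutuallyDual.pointwiseDual (h : MutuallyDual ω Ω E Λ) (x : M) :
    PointwiseDual (ω x) (Ω x) (E x) (Λ x) := by
  refine PointwiseDual.of_equiv (n := n) ?_ (h.regular_covariant.2 x) (fun v => ?_)
    (h.contract_Ω x) (h.contract_Λ x) (h.contract_ω x)
  · change Module.finrank ℝ (Model n) = _
    rw [finrank_euclideanSpace_fin, add_comm]
  · obtain ⟨e, he, he'⟩ := h.inverse x
    have h1 := he' ⟨flat (Ω x) v, v, rfl⟩
    have h2 := he (e.symm ⟨flat (Ω x) v, v, rfl⟩)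
    rw [LinearEquiv.apply_symm_apply, h1] at h2
    exact h2.symm

theorem MutuallyDual.dualNear (h : MutuallyDual ω Ω E Λ) (x : M) :
    DualNear (ω.inChart x) (Ω.inChart x) (E.inChart x) (Λ.inChart x)
      (extChartAt 𝓘(ℝ, Model n) x x) where
  dual := by
    filter_upwards [extChartAt_target_mem_nhds (I := 𝓘(ℝ, Model n)) x] with y hy
    exact (h.pointwiseDual _).transport _ _ (dChart_comp_dChartSymm x hy)
      (dChartSymm_comp_dChart x hy)
  diff_w := (h.regular_covariant.1.1.contDiffAt x).differentiableAt (by simp)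
  diff_form := (h.regular_covariant.1.2.1.contDiffAt x).differentiableAt (by simp)
  diff_e := VecField.differentiableAt_inChart h.regular_contravariant.1.1 x
  diff_bivec := (h.regular_contravariant.1.2.1.contDiffAt x).differentiableAt (by simp)

/-- The transport `ofChart` is the identity, for the same reason as in `dChart_self`. -/
theorem ofChart_eq {k : ℕ} (x : M) (A : (Model n →L[ℝ] ℝ) [⋀^Fin k]→ₗ[ℝ] ℝ) : ofChart x A = A := by
  have h : (dChart x x).inverse = ContinuousLinearMap.id ℝ (Model n) := by
    rw [dChart_self]; exact ContinuousLinearMap.inverse_id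
  ext a
  rw [ofChart, h]
  rfl

theorem OneForm.d_eq (ω : OneForm n M) (x : M) :
    ω.d x = extDeriv (fun y => ContinuousAlternatingMap.ofSubsingleton ℝ (Model n) ℝ (0 : Fin 1)
      (ω.inChart x y)) (extChartAt 𝓘(ℝ, Model n) x x) := by
  rw [OneForm.d, dChart_self]
  rfl

theorem TwoForm.d_eq (Ω : TwoForm n M) (x : M) :
    Ω.d x = extDeriv (Ω.inChart x) (extChartAt 𝓘(ℝ, Model n) x x) := by
  rw [TwoForm.d, dChart_self]
  rfl

theorem lieDeriv_eq (E : VecField n M) (ω : OneForm n M) (x : M) :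
    lieDeriv E ω x =
      lieDerivCovector (E.inChart x) (ω.inChart x) (extChartAt 𝓘(ℝ, Model n) x x) := by
  rw [lieDeriv, dChart_self]
  rfl

/-- `L_E ω = i_E dω`. -/
theorem MutuallyDual.lieDeriv_apply (h : MutuallyDual ω Ω E Λ) (x : M)
    (v : TangentSpace 𝓘(ℝ, Model n) x) : lieDeriv E ω x v = ω.d x ![E x, v] := by
  have h1 := (h.dualNear x).lieDerivCovector_apply v
  rw [VecField.inChart_self, ← lieDeriv_eq, ← OneForm.d_eq] at h1
  exact h1

/-- `[E, Λ] = (Λ^♯ ⊗ Λ^♯)(i_E dΩ) - E ∧ Λ^♯(L_E ω)`. -/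
theorem MutuallyDual.bracketVec_apply (h : MutuallyDual ω Ω E Λ) (x : M)
    (a b : TangentSpace 𝓘(ℝ, Model n) x →L[ℝ] ℝ) :
    bracketVec E Λ x ![a, b] = Ω.d x ![E x, sharp (Λ x) a, sharp (Λ x) b]
      + a (E x) * lieDeriv E ω x (sharp (Λ x) b) - b (E x) * lieDeriv E ω x (sharp (Λ x) a) := by
  have h1 := (h.dualNear x).schoutenVec_eq a b
  rw [VecField.inChart_self, BivecField.inChart_self, ← lieDeriv_eq, ← TwoForm.d_eq] at h1
  rw [bracketVec, ofChart_eq]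
  exact h1

/-- `[Λ, Λ] = 2 E ∧ (Λ^♯ ⊗ Λ^♯)(dω) - 2 (Λ^♯ ⊗ Λ^♯ ⊗ Λ^♯)(dΩ)`. -/
theorem MutuallyDual.bracketBivec_apply (h : MutuallyDual ω Ω E Λ) (x : M)
    (a b c : TangentSpace 𝓘(ℝ, Model n) x →L[ℝ] ℝ) :
    bracketBivec Λ Λ x ![a, b, c] =
      2 * (a (E x) * ω.d x ![sharp (Λ x) b, sharp (Λ x) c]
        + b (E x) * ω.d x ![sharp (Λ x) c, sharp (Λ x) a]
        + c (E x) * ω.d x ![sharp (Λ x) a, sharp (Λ x) b]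
        - Ω.d x ![sharp (Λ x) a, sharp (Λ x) b, sharp (Λ x) c]) := by
  have h1 := (h.dualNear x).schoutenBivec_eq a b c
  rw [VecField.inChart_self, BivecField.inChart_self, ← OneForm.d_eq, ← TwoForm.d_eq] at h1
  rw [bracketBivec, ofChart_eq]
  exact h1

theorem minSmoothness_two_le : minSmoothness ℝ 2 ≤ ((⊤ : ℕ∞) : WithTop ℕ∞) := by
  rw [minSmoothness_of_isRCLikeNormedField]
  exact WithTop.coe_le_coe.2 (le_top : (2 : ℕ∞) ≤ ⊤)

/-! ### The exterior derivative in overlapping charts -/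

/-- A 1-form is recovered from its representation in the chart around `p` by pull-back, at every
point of the domain of the chart. -/
theorem OneForm.inChart_comp_dChart (ω : OneForm n M) (p : M) {q : M}
    (hq : q ∈ (extChartAt 𝓘(ℝ, Model n) p).source) :
    (ω.inChart p (extChartAt 𝓘(ℝ, Model n) p q)).comp (dChart p q) = ω q := by
  set z := extChartAt 𝓘(ℝ, Model n) p q with hz
  have h1 : (ω.inChart p z).comp (dChart p ((extChartAt 𝓘(ℝ, Model n) p).symm z)) =
      ω ((extChartAt 𝓘(ℝ, Model n) p).symm z) := by
    rw [OneForm.inChart, ContinuousLinearMap.comp_assoc,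
      dChartSymm_comp_dChart p ((extChartAt 𝓘(ℝ, Model n) p).map_source hq)]
    rfl
  have h2 : ∀ q', q' = q → (ω.inChart p z).comp (dChart p q') = ω q' →
      (ω.inChart p z).comp (dChart p q) = ω q := by
    rintro q' rfl h; exact h
  exact h2 _ ((extChartAt 𝓘(ℝ, Model n) p).left_inv hq) h1

theorem fderiv_transition (x p : M) {z : Model n} (hz : z ∈ (extChartAt 𝓘(ℝ, Model n) x).target)
    (hz' : (extChartAt 𝓘(ℝ, Model n) x).symm z ∈ (extChartAt 𝓘(ℝ, Model n) p).source) :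
    fderiv ℝ (extChartAt 𝓘(ℝ, Model n) p ∘ (extChartAt 𝓘(ℝ, Model n) x).symm) z =
      (dChart p _).comp (dChartSymm x z) := by
  have := isManifold_one (n := n) (M := M)
  rw [← mfderiv_eq_fderiv]
  have h1 := mdifferentiableWithinAt_extChartAt_symm hz
  rw [ModelWithCorners.range_eq_univ, mdifferentiableWithinAt_univ] at h1
  rw [extChartAt_source] at hz'
  exact mfderiv_comp z (mdifferentiableAt_extChartAt hz') h1

/-- The exterior derivative, computed at each point in the preferred chart around this point, is
represented in any chart by the exterior derivative of the representation. -/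
theorem OneForm.inChart_d {ω : OneForm n M} (hω : ω.Smooth) (x : M) {y : Model n}
    (hy : y ∈ (extChartAt 𝓘(ℝ, Model n) x).target) :
    TwoForm.inChart ω.d x y =
      extDeriv (fun z => ContinuousAlternatingMap.ofSubsingleton ℝ (Model n) ℝ (0 : Fin 1)
        (ω.inChart x z)) y := by
  -- Near `y`, `ω` in the chart around `x` is the pull-back, by the transition map `f`, of `ω` in
  -- the chart around the point `p` with coordinates `y`.
  set p := (extChartAt 𝓘(ℝ, Model n) x).symm y with hp
  set f := extChartAt 𝓘(ℝ, Model n) p ∘ (extChartAt 𝓘(ℝ, Model n) x).symm with hf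
  have hps : p ∈ (extChartAt 𝓘(ℝ, Model n) p).source := mem_extChartAt_source p
  have hcont : ContinuousAt (extChartAt 𝓘(ℝ, Model n) x).symm y := continuousAt_extChartAt_symm'' hy
  have hev : ∀ᶠ z in 𝓝 y, z ∈ (extChartAt 𝓘(ℝ, Model n) x).target ∧
      (extChartAt 𝓘(ℝ, Model n) x).symm z ∈ (extChartAt 𝓘(ℝ, Model n) p).source :=
    Filter.Eventually.and ((isOpen_extChartAt_target x).mem_nhds hy)
      (hcont.preimage_mem_nhds (extChartAt_source_mem_nhds p))
  have hloc : (fun z => ContinuousAlternatingMap.ofSubsingleton ℝ (Model n) ℝ (0 : Fin 1)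
        (ω.inChart x z)) =ᶠ[𝓝 y]
      fun z => (ContinuousAlternatingMap.ofSubsingleton ℝ (Model n) ℝ (0 : Fin 1)
        (ω.inChart p (f z))).compContinuousLinearMap (fderiv ℝ f z) := by
    filter_upwards [hev] with z hz
    rw [fderiv_transition x p hz.1 hz.2]
    have h := ω.inChart_comp_dChart p hz.2
    rw [OneForm.inChart, ← h]
    rfl
  have hfd : ContDiffAt ℝ (⊤ : ℕ∞) f y := by
    have h1 : ContMDiffAt 𝓘(ℝ, Model n) 𝓘(ℝ, Model n) (⊤ : ℕ∞) f y :=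
      (contMDiffAt_extChartAt' (by rwa [extChartAt_source] at hps)).comp y
        ((contMDiffOn_extChartAt_symm x).contMDiffAt ((isOpen_extChartAt_target x).mem_nhds hy))
    exact h1.contDiffAt
  have hωd : DifferentiableAt ℝ (fun z => ContinuousAlternatingMap.ofSubsingleton ℝ (Model n) ℝ
      (0 : Fin 1) (ω.inChart p z)) (f y) :=
    (ContinuousAlternatingMap.ofSubsingletonLIE (𝕜 := ℝ) (E := Model n) (F := ℝ)
      (0 : Fin 1)).toContinuousLinearEquiv.differentiableAt.comp (f y)
        ((hω.contDiffAt p).differentiableAt (by simp))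
  rw [hloc.extDeriv_eq, extDeriv_pullback hωd hfd minSmoothness_two_le,
    fderiv_transition x p hy hps, TwoForm.inChart, OneForm.d_eq, dChart_self]
  rfl

/-- An exact 2-form is closed. -/
theorem TwoForm.d_eq_zero_of_eq_d {ω : OneForm n M} {Ω : TwoForm n M} (hω : ω.Smooth)
    (h : ∀ x, Ω x = ω.d x) (x : M) : Ω.d x = 0 := by
  obtain rfl : Ω = ω.d := funext h
  have hev : TwoForm.inChart ω.d x =ᶠ[𝓝 (extChartAt 𝓘(ℝ, Model n) x x)]
      extDeriv (fun z => ContinuousAlternatingMap.ofSubsingleton ℝ (Model n) ℝ (0 : Fin 1)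
        (ω.inChart x z)) := by
    filter_upwards [extChartAt_target_mem_nhds (I := 𝓘(ℝ, Model n)) x] with y hy
    exact OneForm.inChart_d hω x hy
  have hc : ContDiffAt ℝ (⊤ : ℕ∞) (fun z => ContinuousAlternatingMap.ofSubsingleton ℝ (Model n) ℝ
      (0 : Fin 1) (ω.inChart x z)) (extChartAt 𝓘(ℝ, Model n) x x) :=
    (ContinuousAlternatingMap.ofSubsingletonLIE (𝕜 := ℝ) (E := Model n) (F := ℝ)
      (0 : Fin 1)).toContinuousLinearEquiv.contDiff.contDiffAt.comp _ (hω.contDiffAt x)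
  rw [TwoForm.d_eq, hev.extDeriv_eq, extDeriv_extDeriv_apply hc minSmoothness_two_le]
  rfl

end Charts

/-! ### Testing tensors on the splitting given by dual tensors -/

section Splitting

theorem eq_vec_two {U : Type*} (v : Fin 2 → U) : v = ![v 0, v 1] := by
  ext i; fin_cases i <;> rfl

theorem eq_vec_three {U : Type*} (v : Fin 3 → U) : v = ![v 0, v 1, v 2] := by
  ext i; fin_cases i <;> rfl

variable {W : Type*} [AddCommGroup W] [Module ℝ W] [TopologicalSpace W]

theorem vecOne_wedge_vecOne_apply (X Y : W) (a b : W →L[ℝ] ℝ) :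
    wedge (vecOne X) (vecOne Y) ![a, b] = a X * b Y - b X * a Y :=
  wedge_one_one_apply _ _ _

theorem vecOne_wedge_apply (X : W) (Q : (W →L[ℝ] ℝ) [⋀^Fin 2]→ₗ[ℝ] ℝ) (a b c : W →L[ℝ] ℝ) :
    wedge (vecOne X) Q ![a, b, c] = a X * Q ![b, c] + b X * Q ![c, a] + c X * Q ![a, b] :=
  wedge_one_two_apply _ _ _

theorem threeForm_swap (T : W [⋀^Fin 3]→L[ℝ] ℝ) (u v x : W) : T ![u, v, x] = -T ![v, u, x] := by
  have h := T.map_swap ![v, u, x] (i := 0) (j := 1) (by decide)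
  refine Eq.trans ?_ h
  change T _ = T _
  congr 1
  ext i; fin_cases i <;> rfl

theorem threeForm_rotate (T : W [⋀^Fin 3]→L[ℝ] ℝ) (u v x : W) : T ![u, v, x] = T ![v, x, u] := by
  have h := T.map_swap ![x, v, u] (i := 0) (j := 2) (by decide)
  have h' : T ![u, v, x] = -T ![x, v, u] := by
    refine Eq.trans ?_ h
    change T _ = T _
    congr 1
    ext i; fin_cases i <;> rfl
  rw [h', threeForm_swap, neg_neg]

variable [IsTopologicalAddGroup W] [ContinuousSMul ℝ W] [T2Space W] [FiniteDimensional ℝ W]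

theorem sharpTensor_apply (P : MultiVec 2 W) (θ : W [⋀^Fin 2]→L[ℝ] ℝ) (a b : W →L[ℝ] ℝ) :
    sharpTensor P θ ![a, b] = θ ![sharp P a, sharp P b] := by
  change θ _ = θ _
  congr 1
  ext i; fin_cases i <;> rfl

namespace PointwiseDual

variable {w : W →L[ℝ] ℝ} {Θ : W [⋀^Fin 2]→L[ℝ] ℝ} {e : W} {P : MultiVec 2 W}

/-- A covector is determined by its values on `e` and on the image of `P^♯`, which span. -/
theorem covector_eq_zero (h : PointwiseDual w Θ e P) {f : W →L[ℝ] ℝ} (he : f e = 0)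
    (hs : ∀ a, f (sharp P a) = 0) : f = 0 := by
  ext v
  rw [h.eq_sharp_add v, map_add, map_smul, he, hs]
  simp

/-- A 2-form is determined by its values on `e` and on the image of `P^♯`, which span. -/
theorem twoForm_ext (h : PointwiseDual w Θ e P) {S S' : W [⋀^Fin 2]→L[ℝ] ℝ}
    (he : ∀ v, S ![e, v] = S' ![e, v])
    (hs : ∀ a b, S ![sharp P a, sharp P b] = S' ![sharp P a, sharp P b]) : S = S' := by
  ext v
  rw [eq_vec_two v, h.eq_sharp_add (v 0), h.eq_sharp_add (v 1)]
  simp only [bivec_add_left, bivec_add_right, bivec_smul_left, bivec_smul_right, he, hs,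
    bivec_swap S (sharp P _) e, bivec_swap S' (sharp P _) e]

/-- A 3-form is determined by its values on `e` and on the image of `P^♯`, which span. -/
theorem threeForm_eq_zero (h : PointwiseDual w Θ e P) {T : W [⋀^Fin 3]→L[ℝ] ℝ}
    (he : ∀ a b, T ![e, sharp P a, sharp P b] = 0)
    (hs : ∀ a b c, T ![sharp P a, sharp P b, sharp P c] = 0) : T = 0 := by
  have hadd (u u' v x : W) : T ![u + u', v, x] = T ![u, v, x] + T ![u', v, x] :=
    T.toMultilinearMap.cons_add ![v, x] u u'
  have hsmul (c : ℝ) (u v x : W) : T ![c • u, v, x] = c * T ![u, v, x] :=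
    T.toMultilinearMap.cons_smul ![v, x] c u
  have hself (u x : W) : T ![u, u, x] = 0 :=
    T.map_eq_zero_of_eq ![u, u, x] (i := 0) (j := 1) rfl (by decide)
  -- Arguments are split one at a time into a component in the image of `P^♯` and one along `e`.
  have h1 (a : W →L[ℝ] ℝ) (x : W) : T ![e, sharp P a, x] = 0 := by
    rw [← threeForm_rotate, h.eq_sharp_add x, hadd, hsmul, threeForm_rotate, he, hself]
    simp
  have h2 (v x : W) : T ![e, v, x] = 0 := by
    rw [threeForm_swap, h.eq_sharp_add v, hadd, hsmul, threeForm_swap, h1, hself]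
    simp
  have h3 (a b : W →L[ℝ] ℝ) (x : W) : T ![sharp P a, sharp P b, x] = 0 := by
    rw [← threeForm_rotate, h.eq_sharp_add x, hadd, hsmul, hs, h2]
    simp
  have h4 (a : W →L[ℝ] ℝ) (v x : W) : T ![sharp P a, v, x] = 0 := by
    rw [threeForm_swap, h.eq_sharp_add v, hadd, hsmul, h3, h2]
    simp
  ext v
  rw [eq_vec_three v, h.eq_sharp_add (v 0), hadd, hsmul, h4, h2]
  simp

end PointwiseDual

end Splitting

/-! ### Differential identities and integrability conditions -/

section Correspondence

variable {n : ℕ} {M : Type*} [TopologicalSpace M] [ChartedSpace (Model n) M]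
  [IsManifold 𝓘(ℝ, Model n) (⊤ : ℕ∞) M]
  {ω : OneForm n M} {Ω : TwoForm n M} {E : VecField n M} {Λ : BivecField n M}

namespace MutuallyDual

/-- The brackets have the almost-coPoisson-Jacobi form exactly when `dΩ = 0`, since `dΩ` is the
only obstruction in the identities for the brackets. -/
theorem d_eq_zero_iff (h : MutuallyDual ω Ω E Λ) (x : M) :
    Ω.d x = 0 ↔
      bracketVec E Λ x = -wedge (vecOne (E x)) (vecOne (sharp (Λ x) (lieDeriv E ω x))) ∧
      bracketBivec Λ Λ x = (2 : ℝ) • wedge (vecOne (E x)) (sharpTensor (Λ x) (ω.d x)) := by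
  have key1 (a b : TangentSpace 𝓘(ℝ, Model n) x →L[ℝ] ℝ) :
      bracketVec E Λ x ![a, b] =
        (-wedge (vecOne (E x)) (vecOne (sharp (Λ x) (lieDeriv E ω x)))) ![a, b] +
          Ω.d x ![E x, sharp (Λ x) a, sharp (Λ x) b] := by
    have h1 (c : TangentSpace 𝓘(ℝ, Model n) x →L[ℝ] ℝ) :
        c (sharp (Λ x) (lieDeriv E ω x)) = -lieDeriv E ω x (sharp (Λ x) c) := by
      rw [apply_sharp, apply_sharp, bivec_swap]
    rw [h.bracketVec_apply, AlternatingMap.neg_apply, vecOne_wedge_vecOne_apply, h1, h1]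
    ring
  have key2 (a b c : TangentSpace 𝓘(ℝ, Model n) x →L[ℝ] ℝ) :
      bracketBivec Λ Λ x ![a, b, c] =
        ((2 : ℝ) • wedge (vecOne (E x)) (sharpTensor (Λ x) (ω.d x))) ![a, b, c] -
          2 * Ω.d x ![sharp (Λ x) a, sharp (Λ x) b, sharp (Λ x) c] := by
    rw [h.bracketBivec_apply, AlternatingMap.smul_apply, vecOne_wedge_apply]
    simp only [sharpTensor_apply, smul_eq_mul]
    ring
  constructor
  · intro hd
    constructor
    · ext a
      rw [eq_vec_two a]
      refine (key1 _ _).trans ?_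
      rw [hd]
      exact add_zero _
    · ext a
      rw [eq_vec_three a]
      refine (key2 _ _ _).trans ?_
      rw [hd]
      exact (congrArg _ (mul_zero _)).trans (sub_zero _)
  · rintro ⟨h1, h2⟩
    refine (h.pointwiseDual x).threeForm_eq_zero (fun a b => ?_) fun a b c => ?_
    · have := key1 a b
      rw [h1] at this
      exact (left_eq_add.1 this)
    · have := key2 a b c
      rw [h2] at this
      linarith

/-- Since `i_ω Λ = 0`, the value of `[E, Λ]` on `ω ∧ β` does not involve `dΩ`: it is
`(L_E ω)(Λ^♯ β)`. -/
theorem lieDeriv_eq_zero (h : MutuallyDual ω Ω E Λ) {x : M} (hE : bracketVec E Λ x = 0) :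
    lieDeriv E ω x = 0 := by
  have hp := h.pointwiseDual x
  refine hp.covector_eq_zero ?_ fun b => ?_
  · rw [h.lieDeriv_apply, bivec_self]
  · have h1 := h.bracketVec_apply x (ω x) b
    have h2 : Ω.d x ![E x, 0, sharp (Λ x) b] = 0 :=
      (Ω.d x).map_coord_zero (m := ![E x, 0, sharp (Λ x) b]) 1 rfl
    rw [hE, hp.sharp_self, hp.pairing, h2, map_zero] at h1
    simpa using h1.symm

/-- Since `i_ω Λ = 0`, the contraction of `[Λ, Λ]` with `ω` does not involve `dΩ`. -/
theorem bracketBivec_left (h : MutuallyDual ω Ω E Λ) (x : M)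
    (b c : TangentSpace 𝓘(ℝ, Model n) x →L[ℝ] ℝ) :
    bracketBivec Λ Λ x ![ω x, b, c] = 2 * ω.d x ![sharp (Λ x) b, sharp (Λ x) c] := by
  have hp := h.pointwiseDual x
  have h2 : Ω.d x ![0, sharp (Λ x) b, sharp (Λ x) c] = 0 :=
    (Ω.d x).map_coord_zero (m := ![0, sharp (Λ x) b, sharp (Λ x) c]) 0 rfl
  rw [h.bracketBivec_apply, hp.sharp_self, hp.pairing, h2, bivec_swap _ _ 0, bivec_zero_left,
    bivec_zero_left]
  ring

theorem isAlmostCosymplecticContact_iff (h : MutuallyDual ω Ω E Λ) :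
    IsAlmostCosymplecticContact ω Ω ↔ IsAlmostCoPoissonJacobi E Λ ω := by
  constructor
  · rintro ⟨-, hd, -⟩
    exact ⟨h.regular_contravariant.1, h.regular_covariant.1.1,
      fun x => ((h.d_eq_zero_iff x).1 (hd x)).1, fun x => ((h.d_eq_zero_iff x).1 (hd x)).2,
      h.contract_ω, h.contract_Λ⟩
  · rintro ⟨-, -, h1, h2, -, -⟩
    exact ⟨h.regular_covariant.1, fun x => (h.d_eq_zero_iff x).2 ⟨h1 x, h2 x⟩,
      h.regular_covariant.2⟩

theorem bracketVec_eq_zero (h : MutuallyDual ω Ω E Λ) {x : M} (hd : Ω.d x = 0)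
    (hE : ∀ v, ω.d x ![E x, v] = 0) : bracketVec E Λ x = 0 := by
  ext a
  rw [eq_vec_two a]
  refine (h.bracketVec_apply x _ _).trans ?_
  rw [hd, h.lieDeriv_apply, h.lieDeriv_apply, hE, hE]
  simp

theorem isCosymplectic_iff (h : MutuallyDual ω Ω E Λ) :
    IsCosymplectic ω Ω ↔ IsCoPoisson E Λ := by
  constructor
  · rintro ⟨-, hdω, hdΩ, -⟩
    refine ⟨h.regular_contravariant.1, fun x => ?_, fun x => ?_⟩
    · exact h.bracketVec_eq_zero (hdΩ x) fun v => by rw [hdω]; rfl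
    · ext a
      rw [eq_vec_three a]
      refine (h.bracketBivec_apply x _ _ _).trans ?_
      rw [hdω, hdΩ]
      simp
  · rintro ⟨-, h1, h2⟩
    have hL (x : M) := h.lieDeriv_eq_zero (h1 x)
    have hdω (x : M) : ω.d x = 0 := by
      refine (h.pointwiseDual x).twoForm_ext (fun v => ?_) fun b c => ?_
      · rw [← h.lieDeriv_apply, hL]; rfl
      · have h3 := h.bracketBivec_left x b c
        rw [h2] at h3
        have h4 : (2 : ℝ) * ω.d x ![sharp (Λ x) b, sharp (Λ x) c] = 0 := h3.symm
        change _ = (0 : ℝ)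
        linarith
    refine ⟨h.regular_covariant.1, hdω, fun x => ?_, h.regular_covariant.2⟩
    refine (h.d_eq_zero_iff x).2 ⟨?_, ?_⟩
    · rw [h1, hL, map_zero]
      ext a
      rw [eq_vec_two a]
      have := vecOne_wedge_vecOne_apply (E x) 0 (a 0) (a 1)
      rw [map_zero, map_zero, mul_zero, mul_zero, sub_zero] at this
      exact (neg_eq_zero.2 this).symm
    · rw [h2, hdω]
      ext a
      rw [eq_vec_three a]
      have := vecOne_wedge_apply (E x) (sharpTensor (Λ x) 0) (a 0) (a 1) (a 2)
      have h0 (b c : TangentSpace 𝓘(ℝ, Model n) x →L[ℝ] ℝ) : sharpTensor (Λ x) 0 ![b, c] = 0 :=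
        (sharpTensor_apply (Λ x) 0 b c).trans rfl
      simp only [h0, mul_zero, add_zero] at this
      exact ((congrArg _ this).trans (mul_zero _)).symm

theorem isContact_iff (h : MutuallyDual ω Ω E Λ) : IsContact ω Ω ↔ IsJacobi E Λ := by
  constructor
  · rintro ⟨-, hΩ, -⟩
    have hd := TwoForm.d_eq_zero_of_eq_d h.regular_covariant.1.1 hΩ
    refine ⟨h.regular_contravariant.1, fun x => ?_, fun x => ?_⟩
    · exact h.bracketVec_eq_zero (hd x) fun v => by
        rw [← hΩ]; exact (h.pointwiseDual x).form_left v
    · ext a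
      rw [eq_vec_three a]
      refine (h.bracketBivec_apply x _ _ _).trans ?_
      have h1 := vecOne_wedge_apply (E x) (Λ x).toAlternatingMap (a 0) (a 1) (a 2)
      refine Eq.trans ?_ (congrArg (fun t : ℝ => -(2 * t)) h1).symm
      have h2 (u : Fin 3 → TangentSpace 𝓘(ℝ, Model n) x) : Ω.d x u = 0 := by rw [hd]; rfl
      rw [← hΩ, h2]
      simp only [(h.pointwiseDual x).form_sharp_sharp,
        ContinuousAlternatingMap.coe_toAlternatingMap]
      ring
  · rintro ⟨-, h1, h2⟩
    refine ⟨h.regular_covariant.1, fun x => ?_, h.regular_covariant.2⟩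
    have hp := h.pointwiseDual x
    refine hp.twoForm_ext (fun v => ?_) fun b c => ?_
    · rw [hp.form_left, ← h.lieDeriv_apply, h.lieDeriv_eq_zero (h1 x)]; rfl
    · have h3 := h.bracketBivec_left x b c
      have h4 := vecOne_wedge_apply (E x) (Λ x).toAlternatingMap (ω x) b c
      simp only [ContinuousAlternatingMap.coe_toAlternatingMap, hp.pairing, hp.bivec_left,
        hp.bivec_right, mul_zero, add_zero, one_mul] at h4
      rw [h2] at h3
      have h5 : -(2 * Λ x ![b, c]) = 2 * ω.d x ![sharp (Λ x) b, sharp (Λ x) c] :=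
        (congrArg (fun t : ℝ => -(2 * t)) h4).symm.trans h3
      rw [hp.form_sharp_sharp]
      linarith

end MutuallyDual

end Correspondence

end GeneralizedStructures

end
open GeneralizedStructures in
theorem mainTheorem1 (n : ℕ) {M : Type*} [TopologicalSpace M] [ChartedSpace (Model n) M]
    [IsManifold 𝓘(ℝ, Model n) (⊤ : ℕ∞) M]
    (ω : OneForm n M) (Ω : TwoForm n M) (E : VecField n M) (Λ : BivecField n M)
    (hdual : MutuallyDual ω Ω E Λ) :
    (IsAlmostCosymplecticContact ω Ω ↔ IsAlmostCoPoissonJacobi E Λ ω) ∧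
    (IsCosymplectic ω Ω ↔ IsCoPoisson E Λ) ∧
    (IsContact ω Ω ↔ IsJacobi E Λ) :=
  ⟨hdual.isAlmostCosymplecticContact_iff, hdual.isCosymplectic_iff, hdual.isContact_iff⟩
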